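/- Let $F$ be a field. Algebras are unital but not necessarily associative. For an $F$-algebra $A$ let $\mathrm{Nuc}(A)$ be its nucleus, i.e. the set of $x\in A$ for which all the associators $(x,a,b)$, $(a,x,b)$, $(a,b,x)$ ($a,b\in A$) vanish, and let $\sigma(A)=\mathrm{Nuc}(A)/\mathrm{Jac}(\mathrm{Nuc}(A))$. A nonzero finite-dimensional $F$-algebra $A$ with center $F$ is semiassociative if there is an étale $F$-subalgebra $K\subseteq\mathrm{Nuc}(A)$ such that $A$ is minimally faithful as a $K\otimes_F K$-module via $(k\otimes k')a=kak'$, i.e. $A$ is faithful and no proper section (quotient of submodules) of $A$ is faithful. The atoms of a semiassociative algebra $A$ are the simple components of the semisimple associative algebra $\sigma(A)$. We say that $A$ is homogeneous if all its atoms are $F$-central and they are all Brauer equivalent to each other. For $n\ge 1$ and scalars $c_{ijk}\in F$ ($1\le i,j,k\le n$) with $c_{iij}=c_{jii}=1$ for all $i,j$, the skew matrix algebra $M_n(F;c)$ is the $F$-algebra with basis $e_{ij}$ ($1\le i,j\le n$) and multiplication $e_{ij}e_{k\ell}=\delta_{jk}c_{ij\ell}e_{i\ell}$. Let $A$ be a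 homogeneous semiassociative $F$-algebra. Then its atoms have an underlying division algebra: there is an associative finite-dimensional $F$-central division algebra $D$ such that every atom of $A$ is isomorphic to a matrix algebra $M_k(D)$ for some $k\ge1$. Moreover, for every associative division $F$-algebra $D$ such that every atom of $A$ is isomorphic to some $M_k(D)$, $k\ge1$, there are $n\ge1$ and a skew matrix algebra $A'=M_n(F;c)$ such that $A\cong D\otimes_F A'$ as $F$-algebras. -/

import Mathlib

open scoped TensorProduct

universe u v w

namespace Semiassociative

/-! Throughout, a (unital, not necessarily associative) algebra `A` over a field `F` is given by
`[NonAssocRing A] [Module F A] [IsScalarTower F A A] [SMulCommClass F A A]`. -/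

section Nucleus

variable (F : Type u) (A : Type v) [Field F] [NonAssocRing A] [Module F A]
  [IsScalarTower F A A] [SMulCommClass F A A]

/-- The nucleus: the elements `x` with `(x, A, A) = (A, x, A) = (A, A, x) = 0`, where
`(x, y, z) = (x * y) * z - x * (y * z)` is the associator. -/
def nucleus : NonUnitalSubalgebra F A where
  carrier := {x | ∀ a b : A, associator x a b = 0 ∧ associator a x b = 0 ∧ associator a b x = 0}
  add_mem' := by
    intro x y hx hy a b
    obtain ⟨hx1, hx2, hx3⟩ := hx a b
    obtain ⟨hy1, hy2, hy3⟩ := hy a b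
    simp only [associator_apply, sub_eq_zero] at *
    simp only [add_mul, mul_add]
    exact ⟨by rw [hx1, hy1], by rw [hx2, hy2], by rw [hx3, hy3]⟩
  zero_mem' := by
    intro a b
    simp [associator_apply]
  mul_mem' := by
    intro x y hx hy a b
    simp only [Set.mem_ofPred_eq, associator_apply, sub_eq_zero] at *
    refine ⟨?_, ?_, ?_⟩
    · rw [(hx y a).1, (hx (y * a) b).1, (hx y (a * b)).1, (hy a b).1]
    · rw [← (hx a y).2.1, (hy (a * x) b).2.1, (hx a (y * b)).2.1, (hx y b).1]
    · rw [← (hy (a * b) x).2.2, (hx a b).2.2, (hy a (b * x)).2.2, (hy b x).2.2]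
  smul_mem' := by
    intro r x hx a b
    simp only [Set.mem_ofPred_eq, associator_apply, sub_eq_zero] at *
    obtain ⟨hx1, hx2, hx3⟩ := hx a b
    simp only [smul_mul_assoc, mul_smul_comm]
    exact ⟨by rw [hx1], by rw [hx2], by rw [hx3]⟩

theorem one_mem_nucleus : (1 : A) ∈ nucleus F A := by
  intro a b
  simp [associator_apply]

/-- The nucleus is an associative unital ring. -/
instance nucleusRing : Ring (nucleus F A) :=
  { (inferInstance : NonUnitalNonAssocRing (nucleus F A)) with
    one := ⟨1, one_mem_nucleus F A⟩
    one_mul := fun x => Subtype.ext (one_mul (x : A))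
    mul_one := fun x => Subtype.ext (mul_one (x : A))
    mul_assoc := fun x y z => Subtype.ext (sub_eq_zero.mp (x.2 (y : A) (z : A)).1) }

instance nucleusAlgebra : Algebra F (nucleus F A) :=
  Algebra.ofModule
    (fun r x y => Subtype.ext (smul_mul_assoc r (x : A) (y : A)))
    (fun r x y => Subtype.ext (mul_smul_comm r (x : A) (y : A)))

/-- The semisimple quotient of the nucleus: the nucleus modulo its Jacobson radical. -/
abbrev SemisimpleQuotient : Type v := nucleus F A ⧸ Ring.jacobson (nucleus F A)

/-- `A` is `F`-central: its center (Mathlib's center of a nonassociative algebra, consisting of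
the nuclear elements commuting with everything) is equal to `F`. -/
def IsCentralAlg : Prop :=
  Nontrivial A ∧
    ∀ z ∈ NonUnitalSubalgebra.center F A, ∃ r : F, z = r • (1 : A)

end Nucleus

section Bimodule

variable {F : Type u} {A : Type v} [Field F] [NonAssocRing A] [Module F A]
  [IsScalarTower F A A] [SMulCommClass F A A]

/-- Left multiplication by nuclear elements. -/
def leftAction : nucleus F A →ₐ[F] Module.End F A :=
  AlgHom.ofLinearMap ((LinearMap.mul F A).comp (nucleus F A).toSubmodule.subtype)
    (by ext a; exact one_mul a)
    (by
      intro x y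
      ext a
      exact sub_eq_zero.mp (x.2 (y : A) a).1)

/-- Right multiplication by the elements of a commutative algebra mapping to the nucleus. -/
def rightAction {K : Type v} [CommRing K] [Algebra F K] (ι : K →ₐ[F] nucleus F A) :
    K →ₐ[F] Module.End F A :=
  AlgHom.ofLinearMap
    ((LinearMap.mul F A).flip.comp ((nucleus F A).toSubmodule.subtype.comp ι.toLinearMap))
    (by
      ext a
      change a * ((ι 1 : nucleus F A) : A) = a
      rw [map_one]
      exact mul_one a)
    (by
      intro x y
      ext a
      change a * ((ι (x * y) : nucleus F A) : A) = (a * (ι y : A)) * (ι x : A)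
      rw [mul_comm x y, map_mul]
      exact (sub_eq_zero.mp ((ι x).2 a (ι y : A)).2.2).symm)

theorem commute_leftAction_rightAction {K : Type v} [CommRing K] [Algebra F K]
    (ι : K →ₐ[F] nucleus F A) (k k' : K) :
    Commute ((leftAction.comp ι) k) (rightAction ι k') := by
  refine LinearMap.ext fun a => ?_
  exact (sub_eq_zero.mp ((ι k).2 a (ι k' : A)).1).symm

/-- For a commutative algebra `K` mapping to the nucleus of `A`, the action of `K ⊗ K` on `A`
given by `(k ⊗ k') a = k a k'`. -/
noncomputable def bimoduleAction {K : Type v} [CommRing K] [Algebra F K]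
    (ι : K →ₐ[F] nucleus F A) : K ⊗[F] K →ₐ[F] Module.End F A :=
  Algebra.TensorProduct.lift (leftAction.comp ι) (rightAction ι)
    (commute_leftAction_rightAction ι)

theorem bimoduleAction_tmul {K : Type v} [CommRing K] [Algebra F K]
    (ι : K →ₐ[F] nucleus F A) (k k' : K) (a : A) :
    bimoduleAction ι (k ⊗ₜ k') a = ((ι k : A) * a) * (ι k' : A) := by
  rw [bimoduleAction, Algebra.TensorProduct.lift_tmul]
  exact (sub_eq_zero.mp ((ι k).2 a (ι k' : A)).1).symm

end Bimodule

/-- A module is minimally faithful if it is faithful and has no proper faithful section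
(a section being a quotient `Q / P` of submodules `P ≤ Q`). -/
def IsMinimallyFaithful (R : Type*) (M : Type*) [Ring R] [AddCommGroup M] [Module R M] : Prop :=
  FaithfulSMul R M ∧
    ∀ P Q : Submodule R M, P ≤ Q → FaithfulSMul R (Q ⧸ P.submoduleOf Q) → P = ⊥ ∧ Q = ⊤

section Classes

variable (F : Type u) (A : Type v) [Field F] [NonAssocRing A] [Module F A]
  [IsScalarTower F A A] [SMulCommClass F A A]

/-- `A` is semiassociative: it is finite dimensional and central over `F`, and minimally faithful
over `K ⊗ K` for some étale subalgebra `K` of the nucleus (given as an étale algebra `K` with an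
embedding into the nucleus). -/
def IsSemiassociative : Prop :=
  FiniteDimensional F A ∧ IsCentralAlg F A ∧
    ∃ (K : Type v) (_ : CommRing K) (_ : Algebra F K) (ι : K →ₐ[F] nucleus F A),
      Algebra.Etale F K ∧ Function.Injective ι ∧
        letI : Module (K ⊗[F] K) A := Module.compHom A (bimoduleAction ι).toRingHom
        IsMinimallyFaithful (K ⊗[F] K) A

/-- The associative algebra `S` is (isomorphic to) a simple component of the semisimple quotient
of the nucleus of `A`, i.e. a simple direct factor of it. -/
def IsAtomOf (S : Type v) [Ring S] [Algebra F S] : Prop :=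
  IsSimpleRing S ∧
    ∃ (T : Type v) (_ : Ring T) (_ : Algebra F T),
      Nonempty (SemisimpleQuotient F A ≃ₐ[F] S × T)

/-- All atoms are `F`-central. -/
def IsSemicentral : Prop :=
  IsSemiassociative F A ∧
    ∀ (S : Type v) [Ring S] [Algebra F S], IsAtomOf F A S → Algebra.IsCentral F S

/-- All atoms are `F`-central (hence central simple) and they are Brauer equivalent to each
other. -/
def IsHomogeneous : Prop :=
  IsSemicentral F A ∧
    ∀ S S' : CSA.{u, v} F, IsAtomOf F A S → IsAtomOf F A S' → IsBrauerEquivalent S S'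

/-- The division algebra `D` underlies the atoms of `A`: every atom is a matrix algebra
over `D`. -/
def IsUnderlyingDivisionAlgebra (D : Type w) [DivisionRing D] [Algebra F D] : Prop :=
  ∀ (S : Type v) [Ring S] [Algebra F S], IsAtomOf F A S →
    ∃ k : ℕ, k ≠ 0 ∧ Nonempty (S ≃ₐ[F] Matrix (Fin k) (Fin k) D)

end Classes

section SkewMatrices

/-- A reduced skew set of degree `n`: scalars `c i j k` with `c i i j = c j i i = 1`. -/
structure ReducedSkewSet (F : Type u) [Field F] (n : ℕ) where
  c : Fin n → Fin n → Fin n → F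
  left_one : ∀ i j, c i i j = 1
  right_one : ∀ i j, c j i i = 1

/-- The skew matrix algebra `Mₙ(F; c)`; as a vector space it is the space of matrices. -/
def SkewMatrix {F : Type u} [Field F] {n : ℕ} (_c : ReducedSkewSet F n) : Type u :=
  Matrix (Fin n) (Fin n) F

namespace SkewMatrix

variable {F : Type u} [Field F] {n : ℕ} (c : ReducedSkewSet F n)

instance : AddCommGroup (SkewMatrix c) :=
  inferInstanceAs (AddCommGroup (Matrix (Fin n) (Fin n) F))

instance : Module F (SkewMatrix c) :=
  inferInstanceAs (Module F (Matrix (Fin n) (Fin n) F))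

instance : Mul (SkewMatrix c) where
  mul x y := fun i l => ∑ j, c.c i j l * (x i j * y j l)

instance : One (SkewMatrix c) where
  one := (1 : Matrix (Fin n) (Fin n) F)

/-- The matrix unit `e_{ij}`. -/
def unit (i j : Fin n) : SkewMatrix c := fun a b => if i = a ∧ j = b then 1 else 0

variable {c}

theorem mul_apply (x y : SkewMatrix c) (i l : Fin n) :
    (x * y) i l = ∑ j, c.c i j l * (x i j * y j l) := rfl

theorem add_apply (x y : SkewMatrix c) (i l : Fin n) : (x + y) i l = x i l + y i l := rfl

theorem zero_apply (i l : Fin n) : (0 : SkewMatrix c) i l = 0 := rfl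

theorem smul_apply (r : F) (x : SkewMatrix c) (i l : Fin n) : (r • x) i l = r * x i l := rfl

theorem one_apply (i l : Fin n) : (1 : SkewMatrix c) i l = if i = l then 1 else 0 :=
  Matrix.one_apply

theorem unit_apply (i j a b : Fin n) :
    unit c i j a b = if i = a ∧ j = b then 1 else 0 := rfl

instance : NonAssocRing (SkewMatrix c) :=
  { (inferInstance : AddCommGroup (SkewMatrix c)),
    (inferInstance : Mul (SkewMatrix c)),
    (inferInstance : One (SkewMatrix c)) with
    left_distrib := by
      intro x y z
      funext i l
      simp only [mul_apply, add_apply, mul_add, Finset.sum_add_distrib]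
    right_distrib := by
      intro x y z
      funext i l
      simp only [mul_apply, add_apply, mul_add, add_mul, Finset.sum_add_distrib]
    zero_mul := by
      intro x
      funext i l
      simp [mul_apply, zero_apply]
    mul_zero := by
      intro x
      funext i l
      simp [mul_apply, zero_apply]
    one_mul := by
      intro x
      funext i l
      simp [mul_apply, one_apply, c.left_one]
    mul_one := by
      intro x
      funext i l
      simp [mul_apply, one_apply, c.right_one] }

instance : IsScalarTower F (SkewMatrix c) (SkewMatrix c) where
  smul_assoc r x y := by
    funext i l
    simp only [smul_eq_mul, mul_apply, smul_apply, Finset.mul_sum]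
    exact Finset.sum_congr rfl fun j _ => by ring

instance : SMulCommClass F (SkewMatrix c) (SkewMatrix c) where
  smul_comm r x y := by
    funext i l
    simp only [smul_eq_mul, mul_apply, smul_apply, Finset.mul_sum]
    exact Finset.sum_congr rfl fun j _ => by ring

/-- The defining multiplication rule `e_{ij} e_{kl} = δ_{jk} c_{ijl} e_{il}`. -/
theorem unit_mul_unit (i j k l : Fin n) :
    unit c i j * unit c k l = if j = k then c.c i j l • unit c i l else 0 := by
  funext a b
  rw [mul_apply]
  split_ifs with h
  · subst h
    rw [smul_apply, unit_apply]
    rw [Finset.sum_eq_single j]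
    · simp only [unit_apply]
      by_cases ha : i = a
      · by_cases hb : l = b
        · subst ha hb
          simp
        · simp [hb]
      · simp [ha]
    · intro m _ hm
      simp [unit_apply, hm.symm]
    · simp
  · rw [zero_apply]
    refine Finset.sum_eq_zero fun m _ => ?_
    by_cases h1 : j = m
    · have : k ≠ m := fun h2 => h (h1.trans h2.symm)
      simp [unit_apply, this]
    · simp [unit_apply, h1]

end SkewMatrix

end SkewMatrices

end Semiassociative

/-!
Let `K` be the étale algebra making `A` minimally faithful over `K ⊗ K`. As `K ⊗ K` is semisimple,
`A ≅ K ⊗ K` as a bimodule, and the sub-bimodule `Nuc A` is cyclic. Let `∏ᵢ Bᵢ` be the semisimple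
quotient of `Nuc A`, into which the reduced ring `K` embeds. Being cyclic over `K ⊗ K`, it has its
central idempotents in `K`, say as the images of `εᵢ`, and since `Bᵢ ⊗ Bᵢᵐᵒᵖ ≅ End Bᵢ` its factor
`Bᵢ` has dimension `(dim εᵢ K) ^ 2 = dim εᵢ A εᵢ`. So the surjection from
`εᵢ (Nuc A) εᵢ ⊆ εᵢ A εᵢ` onto `Bᵢ` is an isomorphism, and the map `Nuc A → ∏ᵢ Bᵢ` splits.

If `Bᵢ ≅ M_{kᵢ}(D)` for all `i`, the splitting embeds `D` diagonally into `Nuc A`, and the diagonal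
matrix units become nuclear idempotents commuting with `D` whose Peirce components all have
dimension `dim D`. As `D` is central simple, `A ≅ D ⊗ Z` with `Z` the centralizer of `D`. The Peirce
components of `Z` are then one-dimensional, so `Z` is a skew matrix algebra.
-/

namespace Semiassociative

section LinearAlgebra

variable {F V W U : Type*} [Field F] [AddCommGroup V] [Module F V] [AddCommGroup W] [Module F W]
  [AddCommGroup U] [Module F U]

section

variable [FiniteDimensional F V] {f : V →ₗ[F] W} {g : V →ₗ[F] U}

theorem finrank_range_le_of_ker_le_ker (h : LinearMap.ker f ≤ LinearMap.ker g) :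
    Module.finrank F (LinearMap.range g) ≤ Module.finrank F (LinearMap.range f) := by
  have := f.finrank_range_add_finrank_ker
  have := g.finrank_range_add_finrank_ker
  have := Submodule.finrank_mono h
  omega

theorem ker_eq_ker_of_le_of_finrank_range_le (h : LinearMap.ker f ≤ LinearMap.ker g)
    (hrank : Module.finrank F (LinearMap.range f) ≤ Module.finrank F (LinearMap.range g)) :
    LinearMap.ker f = LinearMap.ker g := by
  refine Submodule.eq_of_le_of_finrank_le h ?_
  have := f.finrank_range_add_finrank_ker
  have := g.finrank_range_add_finrank_ker
  omega

end

theorem finrank_range_tensorMap {V' W' : Type*} [AddCommGroup V'] [Module F V'] [AddCommGroup W']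
    [Module F W'] (f : V →ₗ[F] W) (g : V' →ₗ[F] W') :
    Module.finrank F (LinearMap.range (TensorProduct.map f g)) =
      Module.finrank F (LinearMap.range f) * Module.finrank F (LinearMap.range g) := by
  rw [TensorProduct.range_map, ← TensorProduct.range_mapIncl, LinearMap.finrank_range_of_inj,
    Module.finrank_tensorProduct]
  exact Module.Flat.tensorProduct_mapIncl_injective_of_left _ _

theorem finrank_range_sum_orthogonalIdempotents [FiniteDimensional F V] {J : Type*} [Fintype J]
    {E : J → Module.End F V} (hE : OrthogonalIdempotents E) :
    Module.finrank F (LinearMap.range (∑ j, E j)) =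
      ∑ j, Module.finrank F (LinearMap.range (E j)) := by
  classical
  let toV : (∀ j, LinearMap.range (E j)) →ₗ[F] V :=
    LinearMap.lsum F _ F fun j => (LinearMap.range (E j)).subtype
  have toV_apply : ∀ v, toV v = ∑ j, (v j : V) := fun v => by
    simp only [toV, LinearMap.lsum_apply, LinearMap.sum_apply, LinearMap.comp_apply,
      LinearMap.proj_apply, Submodule.subtype_apply]
  have E_apply : ∀ i j (v : LinearMap.range (E j)), E i v = if i = j then (v : V) else 0 := by
    rintro i j ⟨_, w, rfl⟩
    rw [← Module.End.mul_apply, hE.mul_eq]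
    split_ifs with hij
    · rw [hij]
    · rfl
  have toV_injective : Function.Injective toV := (injective_iff_map_eq_zero toV).mpr fun v hv => by
    refine funext fun i => Subtype.ext ?_
    have := congrArg (E i) hv
    rwa [toV_apply, map_sum, map_zero, Finset.sum_congr rfl fun j _ => E_apply i j (v j),
      Finset.sum_ite_eq, if_pos (Finset.mem_univ i)] at this
  have range_toV : LinearMap.range toV = LinearMap.range (∑ j, E j) := by
    refine le_antisymm ?_ ?_
    · rintro _ ⟨v, rfl⟩
      refine ⟨toV v, ?_⟩
      rw [LinearMap.sum_apply, toV_apply]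
      refine Finset.sum_congr rfl fun i _ => ?_
      rw [map_sum, Finset.sum_congr rfl fun j _ => E_apply i j (v j), Finset.sum_ite_eq,
        if_pos (Finset.mem_univ i)]
    · rintro _ ⟨w, rfl⟩
      exact ⟨fun j => ⟨E j w, w, rfl⟩, by rw [toV_apply, LinearMap.sum_apply]⟩
  rw [← range_toV, LinearMap.finrank_range_of_inj toV_injective, Module.finrank_pi_fintype]

end LinearAlgebra

section CentralSimple

variable (F : Type*) (B : Type*) [Field F] [Ring B] [Algebra F B]

attribute [local instance] TensorProduct.Algebra.module

theorem tmul_op_smul (a b x : B) : (a ⊗ₜ[F] MulOpposite.op b) • x = a * x * b := by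
  change AlgHom.mulLeftRight F B (a ⊗ₜ MulOpposite.op b) x = a * x * b
  rw [AlgHom.mulLeftRight_apply, MulOpposite.unop_op]

theorem isSimpleModule_tensor_op [IsSimpleRing B] : IsSimpleModule (B ⊗[F] Bᵐᵒᵖ) B where
  eq_bot_or_eq_top M := or_iff_not_imp_left.mpr fun hM => by
    obtain ⟨x, hx, hx0⟩ := (Submodule.ne_bot_iff M).mp hM
    let I : TwoSidedIdeal B := .mk' M M.zero_mem M.add_mem M.neg_mem
      (fun {a b} hb => by
        simpa only [tmul_op_smul, mul_one, SetLike.mem_coe] using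
          M.smul_mem (a ⊗ₜ MulOpposite.op 1) hb)
      (fun {a b} ha => by
        simpa only [tmul_op_smul, one_mul, SetLike.mem_coe] using
          M.smul_mem (1 ⊗ₜ MulOpposite.op b) ha)
    have one_mem : (1 : B) ∈ M := by
      simpa [I] using IsSimpleRing.one_mem_of_ne_zero_mem I hx0 (by simpa [I] using hx)
    exact eq_top_iff.mpr fun y _ => by
      simpa only [tmul_op_smul, mul_one] using M.smul_mem (y ⊗ₜ MulOpposite.op 1) one_mem

theorem exists_eq_smul_of_tensor_op_linear [Algebra.IsCentral F B]
    (g : Module.End (B ⊗[F] Bᵐᵒᵖ) B) : ∃ c : F, ∀ x, g x = c • x := by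
  have eq_mul_map_one : ∀ x, g x = x * g 1 := fun x => by
    simpa only [tmul_op_smul, mul_one] using g.map_smul (x ⊗ₜ MulOpposite.op 1) 1
  have eq_map_one_mul : ∀ x, g x = g 1 * x := fun x => by
    simpa only [tmul_op_smul, one_mul] using g.map_smul (1 ⊗ₜ MulOpposite.op x) 1
  obtain ⟨c, hc⟩ := (Algebra.IsCentral.mem_center_iff F).mp <| Subalgebra.mem_center_iff.mpr
    fun x => (eq_mul_map_one x).symm.trans (eq_map_one_mul x)
  exact ⟨c, fun x => by rw [eq_map_one_mul, hc, Algebra.smul_def]⟩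

theorem mulLeftRight_surjective [IsSimpleRing B] [Algebra.IsCentral F B] [FiniteDimensional F B] :
    Function.Surjective (AlgHom.mulLeftRight F B) := by
  have := isSimpleModule_tensor_op F B
  intro f
  let f' : Module.End (Module.End (B ⊗[F] Bᵐᵒᵖ) B) B :=
    { toFun := f
      map_add' := f.map_add
      map_smul' := fun g x => by
        obtain ⟨c, hc⟩ := exists_eq_smul_of_tensor_op_linear F B g
        simp only [Module.End.smul_def, hc, map_smul, RingHom.id_apply] }
  obtain ⟨s, hs⟩ := Module.Finite.fg_top (R := F) (M := B)
  obtain ⟨r, hr⟩ := jacobson_density f' s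
  exact ⟨r, LinearMap.ext_on hs fun x hx => (hr x hx).symm⟩

theorem mulLeftRight_bijective [IsSimpleRing B] [Algebra.IsCentral F B] [FiniteDimensional F B] :
    Function.Bijective (AlgHom.mulLeftRight F B) := by
  have finrank_eq : Module.finrank F (B ⊗[F] Bᵐᵒᵖ) = Module.finrank F (Module.End F B) := by
    rw [Module.finrank_tensorProduct, Module.finrank_linearMap,
      (MulOpposite.opLinearEquiv F : B ≃ₗ[F] Bᵐᵒᵖ).finrank_eq]
  exact ⟨(LinearMap.injective_iff_surjective_of_finrank_eq_finrank
    (f := (AlgHom.mulLeftRight F B).toLinearMap) finrank_eq).mpr (mulLeftRight_surjective F B),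
    mulLeftRight_surjective F B⟩

end CentralSimple

section CentralizingElements

variable {F V D : Type*} [Field F] [AddCommGroup V] [Module F V] [Ring D] [Algebra F D]

/-- The centralizing elements of a bimodule, given by a left and a right action of `D` on `V`. -/
def centralizingSubmodule (l : D →ₐ[F] Module.End F V) (r : Dᵐᵒᵖ →ₐ[F] Module.End F V) :
    Submodule F V where
  carrier := {v | ∀ d, l d v = r (.op d) v}
  add_mem' hv hw d := by rw [map_add, map_add, hv d, hw d]
  zero_mem' d := by rw [map_zero, map_zero]
  smul_mem' c v hv d := by rw [map_smul, map_smul, hv d]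

/-- The map `d ⊗ v ↦ d v` from `D ⊗ Z` to a `D`-bimodule with centralizing elements `Z`. -/
def centralizingMap (l : D →ₐ[F] Module.End F V) (r : Dᵐᵒᵖ →ₐ[F] Module.End F V) :
    D ⊗[F] centralizingSubmodule l r →ₗ[F] V :=
  TensorProduct.lift (l.toLinearMap.compl₂ (centralizingSubmodule l r).subtype)

variable {l : D →ₐ[F] Module.End F V} {r : Dᵐᵒᵖ →ₐ[F] Module.End F V}

theorem centralizingMap_tmul (d : D) (z : centralizingSubmodule l r) :
    centralizingMap l r (d ⊗ₜ z) = l d z := rfl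

theorem lift_apply_of_mem_centralizingSubmodule (hlr : ∀ x y, Commute (l x) (r y))
    (s : D ⊗[F] Dᵐᵒᵖ) (d : D) {z : V} (hz : z ∈ centralizingSubmodule l r) :
    Algebra.TensorProduct.lift l r hlr s (l d z) = l (AlgHom.mulLeftRight F D s d) z := by
  induction s with
  | zero => simp only [map_zero, LinearMap.zero_apply]
  | add s t hs ht => simp only [map_add, LinearMap.add_apply, hs, ht]
  | tmul x y =>
    have right_eq_left : r y z = l y.unop z := (hz y.unop).symm
    rw [Algebra.TensorProduct.lift_tmul, AlgHom.mulLeftRight_apply, map_mul, map_mul,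
      Module.End.mul_apply, Module.End.mul_apply, Module.End.mul_apply, ← right_eq_left,
      ← Module.End.mul_apply (r y), ← (hlr d y).eq, Module.End.mul_apply]

theorem lift_apply_mem_centralizingSubmodule (hlr : ∀ x y, Commute (l x) (r y))
    {s : D ⊗[F] Dᵐᵒᵖ} (hs : ∀ d : D, (d ⊗ₜ 1) * s = (1 ⊗ₜ MulOpposite.op d) * s) (v : V) :
    Algebra.TensorProduct.lift l r hlr s v ∈ centralizingSubmodule l r := fun d => by
  simpa only [map_mul, Algebra.TensorProduct.lift_tmul, map_one, mul_one, one_mul,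
    Module.End.mul_apply] using
    LinearMap.congr_fun (congrArg (Algebra.TensorProduct.lift l r hlr) (hs d)) v

variable [IsSimpleRing D] [FiniteDimensional F D] [Algebra.IsCentral F D]

/-- The elements `t i` of `D ⊗ Dᵐᵒᵖ` acting on `D` as the dual basis `x ↦ bᵢ*(x) 1` project any
bimodule to its centralizing elements, and `∑ i, (b i ⊗ 1) * t i = 1`. -/
theorem centralizingMap_bijective (hlr : ∀ x y, Commute (l x) (r y)) :
    Function.Bijective (centralizingMap l r) := by
  let b := Module.finBasis F D
  choose t ht using fun i => mulLeftRight_surjective F D ((Algebra.linearMap F D) ∘ₗ b.coord i)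
  have ht_apply : ∀ i x, AlgHom.mulLeftRight F D (t i) x = algebraMap F D (b.repr x i) :=
    fun i x => LinearMap.congr_fun (ht i) x
  have ht_comm : ∀ i (d : D), (d ⊗ₜ 1) * t i = (1 ⊗ₜ MulOpposite.op d) * t i := fun i d => by
    refine (mulLeftRight_bijective F D).1 (LinearMap.ext fun x => ?_)
    simp [ht_apply, (Algebra.commutes _ d).symm]
  have sum_ht : ∑ i, (b i ⊗ₜ 1) * t i = 1 := by
    refine (mulLeftRight_bijective F D).1 (LinearMap.ext fun x => ?_)
    simp only [map_sum, map_mul, LinearMap.sum_apply, Module.End.mul_apply, ht_apply,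
      AlgHom.mulLeftRight_apply, MulOpposite.unop_one, mul_one, map_one, Module.End.one_apply]
    simp only [← Algebra.commutes, ← Algebra.smul_def, b.sum_repr]
  let Φ := Algebra.TensorProduct.lift l r hlr
  let coord i : V →ₗ[F] centralizingSubmodule l r :=
    (Φ (t i)).codRestrict _ (lift_apply_mem_centralizingSubmodule hlr (ht_comm i))
  let inv : V →ₗ[F] D ⊗[F] centralizingSubmodule l r :=
    ∑ i, TensorProduct.mk F D _ (b i) ∘ₗ coord i
  have inv_apply : ∀ v, inv v = ∑ i, b i ⊗ₜ coord i v := fun v => by simp [inv]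
  have coord_map : ∀ i d (z : centralizingSubmodule l r), coord i (l d z) = b.repr d i • z :=
    fun i d z => Subtype.ext <| by
      simpa [coord, ht_apply, Algebra.algebraMap_eq_smul_one] using
        lift_apply_of_mem_centralizingSubmodule hlr (t i) d z.2
  refine Function.bijective_iff_has_inverse.mpr ⟨inv, fun x => ?_, fun v => ?_⟩
  · induction x with
    | zero => simp only [map_zero]
    | add x y hx hy => simp only [map_add, hx, hy]
    | tmul d z =>
      simp only [centralizingMap_tmul, inv_apply, coord_map, ← TensorProduct.smul_tmul,
        ← TensorProduct.sum_tmul, b.sum_repr]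
  · have h := LinearMap.congr_fun (congrArg Φ sum_ht) v
    simpa [inv_apply, centralizingMap_tmul, coord, Φ] using h

end CentralizingElements

section Nuclear

variable {F A : Type*} [Field F] [NonAssocRing A] [Module F A] [IsScalarTower F A A]
  [SMulCommClass F A A]

theorem nucleus_mul_assoc_left (x : nucleus F A) (a b : A) : (x * a) * b = x * (a * b) :=
  sub_eq_zero.mp (x.2 a b).1

theorem nucleus_mul_assoc_middle (x : nucleus F A) (a b : A) : (a * x) * b = a * (x * b) :=
  sub_eq_zero.mp (x.2 a b).2.1

theorem nucleus_mul_assoc_right (x : nucleus F A) (a b : A) : (a * b) * x = a * (b * x) :=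
  sub_eq_zero.mp (x.2 a b).2.2

theorem nucleus_coe_mul (x y : nucleus F A) : ((x * y : nucleus F A) : A) = x * y := rfl

theorem nucleus_coe_one : ((1 : nucleus F A) : A) = 1 := rfl

theorem nucleus_coe_sum {ι : Type*} (s : Finset ι) (x : ι → nucleus F A) :
    ((∑ i ∈ s, x i : nucleus F A) : A) = ∑ i ∈ s, (x i : A) :=
  map_sum (nucleus F A).toSubmodule.subtype x s

/-- Right multiplication by nuclear elements; unlike `rightAction`, it is not restricted to a
commutative subalgebra. -/
def rightNuclearAction : (nucleus F A)ᵐᵒᵖ →ₐ[F] Module.End F A :=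
  AlgHom.ofLinearMap
    ((LinearMap.mul F A).flip.comp
      ((nucleus F A).toSubmodule.subtype.comp (MulOpposite.opLinearEquiv F).symm.toLinearMap))
    (LinearMap.ext mul_one)
    (fun x y => LinearMap.ext fun a => (nucleus_mul_assoc_right x.unop a y.unop).symm)

theorem commute_leftAction_rightNuclearAction (x : nucleus F A) (y : (nucleus F A)ᵐᵒᵖ) :
    Commute (leftAction x) (rightNuclearAction y) :=
  LinearMap.ext fun a => (nucleus_mul_assoc_left x a y.unop).symm

/-- The map `a ↦ x a y` for nuclear elements `x` and `y`. -/
def sandwich (x y : nucleus F A) : Module.End F A := leftAction x * rightNuclearAction (.op y)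

theorem sandwich_apply (x y : nucleus F A) (a : A) : sandwich x y a = x * (a * y) := rfl

theorem sandwich_mul (x y x' y' : nucleus F A) :
    sandwich x y * sandwich x' y' = sandwich (x * x') (y' * y) := by
  refine LinearMap.ext fun a => ?_
  simp only [Module.End.mul_apply, sandwich_apply, nucleus_coe_mul, nucleus_mul_assoc_left,
    nucleus_mul_assoc_right]

theorem sandwich_one_one : sandwich (1 : nucleus F A) 1 = 1 :=
  LinearMap.ext fun a => (one_mul (a * 1)).trans (mul_one a)

theorem sandwich_sum_sum {ι κ : Type*} (s : Finset ι) (t : Finset κ) (x : ι → nucleus F A)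
    (y : κ → nucleus F A) :
    sandwich (∑ i ∈ s, x i) (∑ j ∈ t, y j) = ∑ i ∈ s, ∑ j ∈ t, sandwich (x i) (y j) := by
  simp only [sandwich, map_sum, Finset.op_sum, Finset.sum_mul_sum]

/-- The subspace `x A y`; for nuclear idempotents `x` and `y` this is a Peirce component. -/
def peirceComponent (x y : nucleus F A) : Submodule F A := LinearMap.range (sandwich x y)

theorem sandwich_mem_peirceComponent (x y : nucleus F A) (a : A) :
    sandwich x y a ∈ peirceComponent x y := ⟨a, rfl⟩

theorem mul_eq_self_of_mem_peirceComponent {x y : nucleus F A} (hx : IsIdempotentElem x) {a : A}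
    (ha : a ∈ peirceComponent x y) : x * a = a := by
  obtain ⟨b, rfl⟩ := ha
  rw [sandwich_apply, ← nucleus_mul_assoc_left, ← nucleus_coe_mul, hx.eq]

theorem eq_mul_self_of_mem_peirceComponent {x y : nucleus F A} (hy : IsIdempotentElem y) {a : A}
    (ha : a ∈ peirceComponent x y) : a * y = a := by
  obtain ⟨b, rfl⟩ := ha
  rw [sandwich_apply, nucleus_mul_assoc_right, nucleus_mul_assoc_right, ← nucleus_coe_mul, hy.eq]

theorem mem_peirceComponent_of_mul_eq {x y : nucleus F A} {a : A} (hx : x * a = a)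
    (hy : a * y = a) : a ∈ peirceComponent x y :=
  ⟨a, by rw [sandwich_apply, hy, hx]⟩

theorem sandwich_eq_self_of_mem_peirceComponent {x y : nucleus F A} (hx : IsIdempotentElem x)
    (hy : IsIdempotentElem y) {a : A} (ha : a ∈ peirceComponent x y) : sandwich x y a = a := by
  rw [sandwich_apply, eq_mul_self_of_mem_peirceComponent hy ha,
    mul_eq_self_of_mem_peirceComponent hx ha]

theorem mul_mem_peirceComponent {x y z : nucleus F A} (hx : IsIdempotentElem x)
    (hz : IsIdempotentElem z) {a b : A} (ha : a ∈ peirceComponent x y)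
    (hb : b ∈ peirceComponent y z) : a * b ∈ peirceComponent x z :=
  mem_peirceComponent_of_mul_eq
    (by rw [← nucleus_mul_assoc_left, mul_eq_self_of_mem_peirceComponent hx ha])
    (by rw [nucleus_mul_assoc_right, eq_mul_self_of_mem_peirceComponent hz hb])

theorem mul_eq_zero_of_mem_peirceComponent {x y y' z : nucleus F A} (hy : IsIdempotentElem y)
    (hy' : IsIdempotentElem y') (hyy' : y * y' = 0) {a b : A} (ha : a ∈ peirceComponent x y)
    (hb : b ∈ peirceComponent y' z) : a * b = 0 := by
  rw [← eq_mul_self_of_mem_peirceComponent hy ha, ← mul_eq_self_of_mem_peirceComponent hy' hb,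
    nucleus_mul_assoc_middle, ← nucleus_mul_assoc_left, ← nucleus_coe_mul, hyy',
    NonUnitalSubalgebra.coe_zero, zero_mul, mul_zero]

theorem coe_mem_peirceComponent_self {x : nucleus F A} (hx : IsIdempotentElem x) :
    (x : A) ∈ peirceComponent x x := by
  have coe_mul_self : (x : A) * x = x := congrArg Subtype.val hx
  exact mem_peirceComponent_of_mul_eq coe_mul_self coe_mul_self

theorem sum_sandwich_eq_self {ι : Type*} [Fintype ι] {f : ι → nucleus F A}
    (hf : CompleteOrthogonalIdempotents f) (a : A) : ∑ p, ∑ q, sandwich (f p) (f q) a = a := by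
  have h := sandwich_sum_sum Finset.univ Finset.univ f f
  rw [hf.complete, sandwich_one_one] at h
  simpa only [LinearMap.sum_apply, Module.End.one_apply] using (LinearMap.congr_fun h a).symm

end Nuclear

section SkewRecognition

variable {F : Type*} {A : Type*} [Field F] [NonAssocRing A] [Module F A] [IsScalarTower F A A]
  [SMulCommClass F A A] {n : ℕ}

/-- Generators of one-dimensional Peirce components, normalized to be the given idempotents on the
diagonal. They play the role of the matrix units of a skew matrix algebra. -/
structure PeirceUnits (f : Fin n → nucleus F A) where
  /-- The generator of the component `f p * A * f q`. -/
  u : Fin n → Fin n → A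
  diag : ∀ p, u p p = f p
  ne_zero : ∀ p q, u p q ≠ 0
  mem_peirceComponent : ∀ p q, u p q ∈ peirceComponent (f p) (f q)
  exists_eq_smul : ∀ p q, ∀ a ∈ peirceComponent (f p) (f q), ∃ r : F, a = r • u p q

namespace PeirceUnits

variable {f : Fin n → nucleus F A}

theorem nonempty_of_finrank_eq_one (hf : ∀ p, IsIdempotentElem (f p))
    (hdim : ∀ p q, Module.finrank F (peirceComponent (f p) (f q)) = 1) :
    Nonempty (PeirceUnits f) := by
  have coe_ne_zero : ∀ p, (f p : A) ≠ 0 := fun p hp => by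
    refine one_ne_zero ((hdim p p).symm.trans ?_)
    rw [peirceComponent, show sandwich (f p) (f p) = 0 from
      LinearMap.ext fun a => by rw [sandwich_apply, hp, zero_mul, LinearMap.zero_apply],
      LinearMap.range_zero, finrank_bot]
  have exists_generator : ∀ p q, ∃ u ∈ peirceComponent (f p) (f q), u ≠ 0 ∧ (p = q → u = f p) := by
    intro p q
    by_cases hpq : p = q
    · subst hpq
      exact ⟨f p, coe_mem_peirceComponent_self (hf p), coe_ne_zero p, fun _ => rfl⟩
    · obtain ⟨u, hu0, -⟩ := finrank_eq_one_iff'.mp (hdim p q)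
      exact ⟨u, u.2, fun h => hu0 (Subtype.ext h), fun h => absurd h hpq⟩
  choose u hu hu0 hdiag using exists_generator
  refine ⟨u, fun p => hdiag p p rfl, hu0, hu, fun p q a ha => ?_⟩
  obtain ⟨r, hr⟩ := exists_smul_eq_of_finrank_eq_one (hdim p q)
    (x := ⟨u p q, hu p q⟩) (fun h => hu0 p q (congrArg Subtype.val h)) ⟨a, ha⟩
  exact ⟨r, (congrArg Subtype.val hr).symm⟩

variable (U : PeirceUnits f)

theorem exists_mul_eq_smul (hf : OrthogonalIdempotents f) (p q l : Fin n) :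
    ∃ r : F, U.u p q * U.u q l = r • U.u p l :=
  U.exists_eq_smul p l _ <| mul_mem_peirceComponent (hf.idem p) (hf.idem l)
    (U.mem_peirceComponent p q) (U.mem_peirceComponent q l)

theorem mul_of_ne (hf : OrthogonalIdempotents f) {p q q' l : Fin n} (hq : q ≠ q') :
    U.u p q * U.u q' l = 0 :=
  mul_eq_zero_of_mem_peirceComponent (hf.idem q) (hf.idem q') (hf.ortho hq)
    (U.mem_peirceComponent p q) (U.mem_peirceComponent q' l)

theorem sandwich_apply_u (hf : OrthogonalIdempotents f) (p q p' q' : Fin n) :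
    sandwich (f p) (f q) (U.u p' q') = if p = p' ∧ q = q' then U.u p' q' else 0 := by
  split_ifs with h
  · obtain ⟨rfl, rfl⟩ := h
    exact sandwich_eq_self_of_mem_peirceComponent (hf.idem p) (hf.idem q)
      (U.mem_peirceComponent p q)
  · have hu := U.mem_peirceComponent p' q'
    rw [sandwich_apply]
    obtain hp | hq := not_and_or.mp h
    · rw [← nucleus_mul_assoc_left, mul_eq_zero_of_mem_peirceComponent (hf.idem p) (hf.idem p')
        (hf.ortho hp) (coe_mem_peirceComponent_self (hf.idem p)) hu, zero_mul]
    · rw [mul_eq_zero_of_mem_peirceComponent (hf.idem q') (hf.idem q)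
        (hf.ortho (Ne.symm hq)) hu (coe_mem_peirceComponent_self (hf.idem q)), mul_zero]

theorem exists_reducedSkewSet (hf : OrthogonalIdempotents f) :
    ∃ c : ReducedSkewSet F n, ∀ p q l, U.u p q * U.u q l = c.c p q l • U.u p l := by
  choose c hc using U.exists_mul_eq_smul hf
  have eq_one : ∀ (p q : Fin n) {r : F}, U.u p q = r • U.u p q → r = 1 := fun p q _ h =>
    smul_left_injective F (U.ne_zero p q) (h.symm.trans (one_smul F _).symm)
  refine ⟨⟨c, fun i j => eq_one i j ?_, fun i j => eq_one j i ?_⟩, hc⟩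
  · rw [← hc, U.diag,
      mul_eq_self_of_mem_peirceComponent (hf.idem i) (U.mem_peirceComponent i j)]
  · rw [← hc, U.diag,
      eq_mul_self_of_mem_peirceComponent (hf.idem i) (U.mem_peirceComponent j i)]

/-- The map `x ↦ ∑ x_{pq} u_{pq}`. -/
def toLinearMap (c : ReducedSkewSet F n) : SkewMatrix c →ₗ[F] A where
  toFun x := ∑ p, ∑ q, x p q • U.u p q
  map_add' x y := by simp only [SkewMatrix.add_apply, add_smul, Finset.sum_add_distrib]
  map_smul' r x := by
    simp only [SkewMatrix.smul_apply, mul_smul, Finset.smul_sum, RingHom.id_apply]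

theorem toLinearMap_apply (c : ReducedSkewSet F n) (x : SkewMatrix c) :
    U.toLinearMap c x = ∑ p, ∑ q, x p q • U.u p q := rfl

theorem sandwich_toLinearMap (hf : OrthogonalIdempotents f) (c : ReducedSkewSet F n)
    (x : SkewMatrix c) (p q : Fin n) :
    sandwich (f p) (f q) (U.toLinearMap c x) = x p q • U.u p q := by
  simp only [toLinearMap_apply, map_sum, map_smul, U.sandwich_apply_u hf, ite_and, smul_ite,
    smul_zero, Finset.sum_ite_irrel, Finset.sum_const_zero, Finset.sum_ite_eq, Finset.mem_univ,
    if_true]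

theorem toLinearMap_injective (hf : OrthogonalIdempotents f) (c : ReducedSkewSet F n) :
    Function.Injective (U.toLinearMap c) :=
  (injective_iff_map_eq_zero _).mpr fun x hx => funext fun p => funext fun q => by
    have smul_eq_zero_pq : x p q • U.u p q = 0 := by
      rw [← U.sandwich_toLinearMap hf, hx, map_zero]
    exact (smul_eq_zero.mp smul_eq_zero_pq).resolve_right (U.ne_zero p q)

theorem toLinearMap_mul (hf : OrthogonalIdempotents f) {c : ReducedSkewSet F n}
    (hc : ∀ p q l, U.u p q * U.u q l = c.c p q l • U.u p l) (x y : SkewMatrix c) :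
    U.toLinearMap c (x * y) = U.toLinearMap c x * U.toLinearMap c y := by
  have u_mul : ∀ p q, U.u p q * U.toLinearMap c y = ∑ l, (c.c p q l * y q l) • U.u p l := by
    intro p q
    simp only [toLinearMap_apply, Finset.mul_sum, mul_smul_comm]
    rw [Finset.sum_eq_single q (fun q' _ hq' => by simp [U.mul_of_ne hf hq'.symm]) (by simp)]
    exact Finset.sum_congr rfl fun l _ => by rw [hc, smul_smul, mul_comm]
  rw [U.toLinearMap_apply c x]
  simp only [Finset.sum_mul, smul_mul_assoc, u_mul, Finset.smul_sum, smul_smul]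
  simp only [toLinearMap_apply, SkewMatrix.mul_apply, Finset.sum_smul]
  refine Finset.sum_congr rfl fun p _ => Finset.sum_comm.trans ?_
  simp only [mul_left_comm]

theorem toLinearMap_one (c : ReducedSkewSet F n) (hf : CompleteOrthogonalIdempotents f) :
    U.toLinearMap c 1 = 1 := by
  simp only [toLinearMap_apply, SkewMatrix.one_apply, ite_smul, one_smul, zero_smul,
    Finset.sum_ite_eq, Finset.mem_univ, if_true, U.diag]
  rw [← nucleus_coe_sum, hf.complete, nucleus_coe_one]

theorem toLinearMap_surjective (c : ReducedSkewSet F n) (hf : CompleteOrthogonalIdempotents f) :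
    Function.Surjective (U.toLinearMap c) := fun a => by
  choose x hx using fun p q =>
    U.exists_eq_smul p q _ (sandwich_mem_peirceComponent (f p) (f q) a)
  have sum_eq := sum_sandwich_eq_self hf a
  simp only [hx] at sum_eq
  exact ⟨x, sum_eq⟩

end PeirceUnits

theorem exists_equiv_skewMatrix {f : Fin n → nucleus F A} (hf : CompleteOrthogonalIdempotents f)
    (hdim : ∀ p q, Module.finrank F (peirceComponent (f p) (f q)) = 1) :
    ∃ (c : ReducedSkewSet F n) (e : SkewMatrix c ≃ₗ[F] A),
      e 1 = 1 ∧ ∀ x y, e (x * y) = e x * e y := by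
  obtain ⟨U⟩ := PeirceUnits.nonempty_of_finrank_eq_one hf.idem hdim
  have hfo := hf.toOrthogonalIdempotents
  obtain ⟨c, hc⟩ := U.exists_reducedSkewSet hfo
  exact ⟨c, .ofBijective (U.toLinearMap c)
    ⟨U.toLinearMap_injective hfo c, U.toLinearMap_surjective c hf⟩,
    U.toLinearMap_one c hf, U.toLinearMap_mul hfo hc⟩

end SkewRecognition

section NuclearCentralizer

variable {F A D : Type*} [Field F] [NonAssocRing A] [Module F A] [IsScalarTower F A A]
  [SMulCommClass F A A] [Ring D] [Algebra F D] (δ : D →ₐ[F] nucleus F A)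

/-- The centralizer in `A` of a subalgebra of the nucleus. -/
def nuclearCentralizer : NonUnitalSubalgebra F A :=
  { centralizingSubmodule (leftAction.comp δ) (rightNuclearAction.comp δ.op) with
    mul_mem' := fun {a b} (ha : ∀ d, (δ d : A) * a = a * δ d) (hb : ∀ d, (δ d : A) * b = b * δ d)
        d => by
      change (δ d : A) * (a * b) = a * b * δ d
      rw [← nucleus_mul_assoc_left, ha, nucleus_mul_assoc_middle, hb, nucleus_mul_assoc_right] }

theorem mem_nuclearCentralizer {a : A} :
    a ∈ nuclearCentralizer δ ↔ ∀ d, (δ d : A) * a = a * δ d := Iff.rfl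

instance : NonAssocRing (nuclearCentralizer δ) :=
  { (inferInstance : NonUnitalNonAssocRing (nuclearCentralizer δ)) with
    one := ⟨1, fun d => (mul_one (δ d : A)).trans (one_mul (δ d : A)).symm⟩
    one_mul := fun a => Subtype.ext (one_mul (a : A))
    mul_one := fun a => Subtype.ext (mul_one (a : A)) }

theorem nuclearCentralizer_coe_one : ((1 : nuclearCentralizer δ) : A) = 1 := rfl

theorem nuclearCentralizer_coe_mul (a b : nuclearCentralizer δ) :
    ((a * b : nuclearCentralizer δ) : A) = a * b := rfl

/-- The map `d ⊗ z ↦ d z` from `D ⊗ Z` to `A`, where `Z` is the centralizer of `D`. -/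
def tensorCentralizerMap : D ⊗[F] nuclearCentralizer δ →ₗ[F] A :=
  centralizingMap (leftAction.comp δ) (rightNuclearAction.comp δ.op)

theorem tensorCentralizerMap_tmul (d : D) (z : nuclearCentralizer δ) :
    tensorCentralizerMap δ (d ⊗ₜ z) = δ d * z := rfl

theorem tensorCentralizerMap_bijective [IsSimpleRing D] [FiniteDimensional F D]
    [Algebra.IsCentral F D] : Function.Bijective (tensorCentralizerMap δ) :=
  centralizingMap_bijective fun _ _ => commute_leftAction_rightNuclearAction _ _

theorem tensorCentralizerMap_one : tensorCentralizerMap δ 1 = 1 := by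
  rw [Algebra.TensorProduct.one_def, tensorCentralizerMap_tmul, map_one, nucleus_coe_one, one_mul,
    nuclearCentralizer_coe_one]

theorem tensorCentralizerMap_mul (x y : D ⊗[F] nuclearCentralizer δ) :
    tensorCentralizerMap δ (x * y) = tensorCentralizerMap δ x * tensorCentralizerMap δ y := by
  induction x with
  | zero => simp only [zero_mul, map_zero]
  | add x x' hx hx' => simp only [add_mul, map_add, hx, hx']
  | tmul d z =>
    induction y with
    | zero => simp only [mul_zero, map_zero]
    | add y y' hy hy' => simp only [mul_add, map_add, hy, hy']
    | tmul d' z' =>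
      simp only [Algebra.TensorProduct.tmul_mul_tmul, tensorCentralizerMap_tmul, map_mul,
        nucleus_coe_mul, nuclearCentralizer_coe_mul]
      rw [nucleus_mul_assoc_left, nucleus_mul_assoc_left, ← nucleus_mul_assoc_left (δ d') z,
        (mem_nuclearCentralizer δ).mp z.2, nucleus_mul_assoc_middle]

/-- An element of the nucleus of `A` commuting with `D`, as an element of the nucleus of the
centralizer of `D`. -/
def toNucleusCentralizer (x : nucleus F A) (hx : ∀ d, Commute (δ d) x) :
    nucleus F (nuclearCentralizer δ) :=
  ⟨⟨x, fun d => congrArg Subtype.val (hx d).eq⟩, fun a b =>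
    ⟨Subtype.ext (x.2 a b).1, Subtype.ext (x.2 a b).2.1, Subtype.ext (x.2 a b).2.2⟩⟩

theorem finrank_peirceComponent_eq_mul [IsSimpleRing D] [FiniteDimensional F D]
    [Algebra.IsCentral F D] {x y : nucleus F A} (hx : ∀ d, Commute (δ d) x)
    (hy : ∀ d, Commute (δ d) y) :
    Module.finrank F (peirceComponent x y) = Module.finrank F D * Module.finrank F
      (peirceComponent (toNucleusCentralizer δ x hx) (toNucleusCentralizer δ y hy)) := by
  let e := LinearEquiv.ofBijective _ (tensorCentralizerMap_bijective δ)
  let E := sandwich (toNucleusCentralizer δ x hx) (toNucleusCentralizer δ y hy)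
  have comp_eq : sandwich x y ∘ₗ e.toLinearMap = e.toLinearMap ∘ₗ E.lTensor D := by
    refine TensorProduct.ext' fun d z => ?_
    change (x : A) * ((δ d * z) * y) = δ d * (x * (z * y))
    rw [nucleus_mul_assoc_left, ← nucleus_mul_assoc_left x, ← nucleus_coe_mul, ← (hx d).eq,
      nucleus_coe_mul, nucleus_mul_assoc_left]
  have range_eq : peirceComponent x y = (LinearMap.range (E.lTensor D)).map e.toLinearMap := by
    rw [← LinearMap.range_comp, ← comp_eq, LinearMap.range_comp_of_range_eq_top _ e.range]
    rfl
  rw [range_eq, LinearEquiv.finrank_map_eq, LinearMap.lTensor, finrank_range_tensorMap,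
    LinearMap.range_id, finrank_top]
  rfl

theorem completeOrthogonalIdempotents_toNucleusCentralizer {n : ℕ} {f : Fin n → nucleus F A}
    (hf : CompleteOrthogonalIdempotents f) (hcomm : ∀ p d, Commute (δ d) (f p)) :
    CompleteOrthogonalIdempotents fun p => toNucleusCentralizer δ (f p) (hcomm p) where
  idem p := Subtype.ext (Subtype.ext (congrArg Subtype.val (hf.idem p).eq :))
  ortho _ _ hpq := Subtype.ext (Subtype.ext (congrArg Subtype.val (hf.ortho hpq) :))
  complete := Subtype.ext <| Subtype.ext <| by
    have coe_sum : ∀ z : Fin n → nuclearCentralizer δ, ((∑ p, z p :) : A) = ∑ p, (z p : A) :=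
      fun z => map_sum (nuclearCentralizer δ).toSubmodule.subtype z _
    rw [nucleus_coe_sum, coe_sum, nucleus_coe_one, nuclearCentralizer_coe_one,
      ← nucleus_coe_one (F := F), ← hf.complete, nucleus_coe_sum]
    rfl

theorem lTensor_mul {B C : Type*} [NonAssocRing B] [Module F B] [IsScalarTower F B B]
    [SMulCommClass F B B] [NonAssocRing C] [Module F C] [IsScalarTower F C C] [SMulCommClass F C C]
    (g : B →ₗ[F] C) (hg : ∀ x y, g (x * y) = g x * g y) (x y : D ⊗[F] B) :
    g.lTensor D (x * y) = g.lTensor D x * g.lTensor D y := by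
  induction x with
  | zero => simp only [zero_mul, map_zero]
  | add x x' hx hx' => simp only [add_mul, map_add, hx, hx']
  | tmul d b =>
    induction y with
    | zero => simp only [mul_zero, map_zero]
    | add y y' hy hy' => simp only [mul_add, map_add, hy, hy']
    | tmul d' b' => simp only [Algebra.TensorProduct.tmul_mul_tmul, LinearMap.lTensor_tmul, hg]

theorem exists_equiv_tensor_skewMatrix [IsSimpleRing D] [FiniteDimensional F D]
    [Algebra.IsCentral F D] {n : ℕ} {f : Fin n → nucleus F A}
    (hf : CompleteOrthogonalIdempotents f) (hcomm : ∀ p d, Commute (δ d) (f p))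
    (hdim : ∀ p q, Module.finrank F (peirceComponent (f p) (f q)) = Module.finrank F D) :
    ∃ (c : ReducedSkewSet F n) (e : A ≃ₗ[F] D ⊗[F] SkewMatrix c),
      e 1 = 1 ∧ ∀ x y : A, e (x * y) = e x * e y := by
  have finrank_eq_one : ∀ p q, Module.finrank F (peirceComponent
      (toNucleusCentralizer δ (f p) (hcomm p)) (toNucleusCentralizer δ (f q) (hcomm q))) = 1 :=
    fun p q => Nat.eq_of_mul_eq_mul_left (Module.finrank_pos (R := F) (M := D)) <| by
      rw [← finrank_peirceComponent_eq_mul, hdim, mul_one]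
  obtain ⟨c, e, e_one, e_mul⟩ := exists_equiv_skewMatrix
    (completeOrthogonalIdempotents_toNucleusCentralizer δ hf hcomm) finrank_eq_one
  let T : D ⊗[F] SkewMatrix c ≃ₗ[F] A :=
    (e.lTensor D).trans (.ofBijective _ (tensorCentralizerMap_bijective δ))
  have T_one : T 1 = 1 := by
    rw [← tensorCentralizerMap_one δ, Algebra.TensorProduct.one_def,
      Algebra.TensorProduct.one_def, ← e_one]
    rfl
  have T_mul : ∀ x y, T (x * y) = T x * T y := fun x y =>
    (congrArg _ (lTensor_mul e.toLinearMap e_mul x y)).trans (tensorCentralizerMap_mul δ _ _)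
  exact ⟨c, T.symm, T.symm_apply_eq.mpr T_one.symm, fun x y => T.symm_apply_eq.mpr <| by
    rw [T_mul, T.apply_symm_apply, T.apply_symm_apply]⟩

end NuclearCentralizer

section Bimodules

variable {F K B C : Type*} [Field F] [CommRing K] [Algebra F K] [Ring B] [Algebra F B]
  [Ring C] [Algebra F C]

/-- For a commutative algebra `K` mapping to an associative algebra `B`, the action of `K ⊗ K` on
`B` given by `(k ⊗ k') b = k b k'`. -/
noncomputable def bimoduleEnd (g : K →ₐ[F] B) : K ⊗[F] K →ₐ[F] Module.End F B :=
  (AlgHom.mulLeftRight F B).comp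
    (Algebra.TensorProduct.map g (g.op.comp (AlgEquiv.toOpposite F K).toAlgHom))

theorem bimoduleEnd_tmul (g : K →ₐ[F] B) (k k' : K) (b : B) :
    bimoduleEnd g (k ⊗ₜ k') b = g k * b * g k' := by
  simp [bimoduleEnd]

theorem map_bimoduleEnd (p : B →ₐ[F] C) (g : K →ₐ[F] B) (r : K ⊗[F] K) (b : B) :
    p (bimoduleEnd g r b) = bimoduleEnd (p.comp g) r (p b) := by
  induction r with
  | zero => simp
  | add x y hx hy => simp [hx, hy]
  | tmul x y => simp [bimoduleEnd_tmul]

theorem bimoduleEnd_one (g : K →ₐ[F] B) (r : K ⊗[F] K) :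
    bimoduleEnd g r 1 = g (Algebra.TensorProduct.lmul' F r) := by
  induction r with
  | zero => simp
  | add x y hx hy => simp [hx, hy]
  | tmul x y => simp [bimoduleEnd_tmul]

theorem bimoduleEnd_mul_of_commute (g : K →ₐ[F] B) {c : B} (hc : ∀ k, Commute c (g k))
    (r : K ⊗[F] K) (b : B) : bimoduleEnd g r (c * b) = c * bimoduleEnd g r b := by
  induction r with
  | zero => simp
  | add x y hx hy => simp [hx, hy, mul_add]
  | tmul x y => simp only [bimoduleEnd_tmul, ← mul_assoc, (hc x).eq]

theorem bimoduleEnd_comm (g : K →ₐ[F] B) (r s : K ⊗[F] K) (b : B) :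
    bimoduleEnd g r (bimoduleEnd g s b) = bimoduleEnd g s (bimoduleEnd g r b) := by
  rw [← Module.End.mul_apply, ← map_mul, mul_comm, map_mul, Module.End.mul_apply]

theorem surjective_bimoduleEnd_comp {p : B →ₐ[F] C} (hp : Function.Surjective p) {g : K →ₐ[F] B}
    {b₀ : B} (hb₀ : Function.Surjective fun r => bimoduleEnd g r b₀) :
    Function.Surjective fun r => bimoduleEnd (p.comp g) r (p b₀) := by
  simpa only [← map_bimoduleEnd, Function.comp_def] using hp.comp hb₀

/-- If `B` is generated by `b₀`, the annihilator of `b₀` in the commutative ring `K ⊗ K` kills all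
of `B`; as `B ⊗ Bᵐᵒᵖ` acts faithfully on `B`, it is the kernel of `g ⊗ g`. -/
theorem finrank_eq_sq_finrank_range [IsSimpleRing B] [Algebra.IsCentral F B]
    [FiniteDimensional F B] [FiniteDimensional F K] {g : K →ₐ[F] B} {b₀ : B}
    (hb₀ : Function.Surjective fun r => bimoduleEnd g r b₀) :
    Module.finrank F B = Module.finrank F (LinearMap.range g.toLinearMap) ^ 2 := by
  let actOn : K ⊗[F] K →ₗ[F] B := LinearMap.applyₗ b₀ ∘ₗ (bimoduleEnd g).toLinearMap
  let op : B ≃ₗ[F] Bᵐᵒᵖ := MulOpposite.opLinearEquiv F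
  let gg := TensorProduct.map g.toLinearMap (op.toLinearMap ∘ₗ g.toLinearMap)
  have mulLeftRight_gg : ∀ r, AlgHom.mulLeftRight F B (gg r) = bimoduleEnd g r := fun r => rfl
  have ker_le : LinearMap.ker gg ≤ LinearMap.ker actOn := fun r hr => by
    have hr' : gg r = 0 := hr
    change bimoduleEnd g r b₀ = 0
    rw [← mulLeftRight_gg, hr', map_zero, LinearMap.zero_apply]
  have le_ker : LinearMap.ker actOn ≤ LinearMap.ker gg := fun r hr => by
    refine (mulLeftRight_bijective F B).1 (LinearMap.ext fun b => ?_)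
    obtain ⟨s, rfl⟩ := hb₀ b
    have hr' : bimoduleEnd g r b₀ = 0 := hr
    rw [mulLeftRight_gg, bimoduleEnd_comm, hr', map_zero, map_zero, LinearMap.zero_apply]
  have range_actOn : LinearMap.range actOn = ⊤ := LinearMap.range_eq_top.mpr hb₀
  rw [← finrank_top F B, ← range_actOn, (finrank_range_le_of_ker_le_ker ker_le).antisymm
    (finrank_range_le_of_ker_le_ker le_ker), finrank_range_tensorMap, LinearMap.range_comp,
    LinearEquiv.finrank_map_eq, sq]

/-- A cyclic bimodule `K ⊗ K → B` is commutative as a ring of operators, so multiplication by a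
central element of `B` agrees with some operator `r`; then `r` applied to `1` lies in `K`. -/
theorem exists_map_eq_of_mem_center {g : K →ₐ[F] B} {b₀ : B}
    (hb₀ : Function.Surjective fun r => bimoduleEnd g r b₀) {c : B}
    (hc : c ∈ Subalgebra.center F B) : ∃ k, g k = c := by
  have commute_c : ∀ k, Commute c (g k) := fun k => (Subalgebra.mem_center_iff.mp hc (g k)).symm
  obtain ⟨r, hr : bimoduleEnd g r b₀ = c * b₀⟩ := hb₀ (c * b₀)
  have r_eq : ∀ b, bimoduleEnd g r b = c * b := fun b => by
    obtain ⟨s, rfl⟩ := hb₀ b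
    rw [bimoduleEnd_comm, hr, bimoduleEnd_mul_of_commute g commute_c]
  exact ⟨Algebra.TensorProduct.lmul' F r, by rw [← bimoduleEnd_one, r_eq, mul_one]⟩

theorem exists_completeOrthogonalIdempotents_map_eq_single {I : Type*} [Fintype I] [DecidableEq I]
    {B : I → Type*} [∀ i, Ring (B i)] [∀ i, Algebra F (B i)] {q : K →ₐ[F] ∀ i, B i}
    (hq : Function.Injective q) {b₀ : ∀ i, B i}
    (hb₀ : Function.Surjective fun r => bimoduleEnd q r b₀) :
    ∃ ε : I → K, CompleteOrthogonalIdempotents ε ∧ ∀ i, q (ε i) = Pi.single i 1 := by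
  have single_mem_center : ∀ i, (Pi.single i 1 : ∀ i, B i) ∈ Subalgebra.center F (∀ i, B i) :=
    fun i => Subalgebra.mem_center_iff.mpr fun b => by
      rw [← Pi.single_mul_left, ← Pi.single_mul_right, one_mul, mul_one]
  choose ε hε using fun i => exists_map_eq_of_mem_center hb₀ (single_mem_center i)
  refine ⟨ε, (CompleteOrthogonalIdempotents.map_injective_iff q.toRingHom hq).mp ?_, hε⟩
  rw [show q.toRingHom ∘ ε = (Pi.single · 1) from funext hε]
  exact CompleteOrthogonalIdempotents.single B

end Bimodules

section Splitting

variable {F N I : Type*} [Field F] [Ring N] [Algebra F N] [Fintype I]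

theorem sum_corner_mem_centralizer {e : I → N} (he : OrthogonalIdempotents e) (x : N) :
    ∑ i, e i * x * e i ∈ Subalgebra.centralizer F (Set.range e) := by
  rw [Subalgebra.mem_centralizer_iff]
  rintro _ ⟨j, rfl⟩
  simp only [Finset.mul_sum, Finset.sum_mul]
  rw [Finset.sum_eq_single j (fun i _ hij => by rw [← mul_assoc, ← mul_assoc, he.ortho hij.symm,
    zero_mul, zero_mul]) (by simp), Finset.sum_eq_single j (fun i _ hij => by
    rw [mul_assoc, he.ortho hij, mul_zero]) (by simp)]
  rw [← mul_assoc, ← mul_assoc, (he.idem j).eq, mul_assoc _ (e j), (he.idem j).eq]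

theorem sum_corner_eq_self {e : I → N} (he : CompleteOrthogonalIdempotents e) {x : N}
    (hx : x ∈ Subalgebra.centralizer F (Set.range e)) : ∑ i, e i * x * e i = x := by
  have commute_e : ∀ i, e i * x = x * e i := fun i =>
    (Subalgebra.mem_centralizer_iff F).mp hx _ ⟨i, rfl⟩
  simp only [commute_e, mul_assoc, (he.idem _).eq]
  rw [← Finset.mul_sum, he.complete, mul_one]

/-- The surjection `p` restricts to an isomorphism on the centralizer of the idempotents `e i`. -/
theorem exists_algHom_map_single_eq [DecidableEq I] {B : I → Type*} [∀ i, Ring (B i)]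
    [∀ i, Algebra F (B i)] {p : N →ₐ[F] ∀ i, B i} (hp : Function.Surjective p) {e : I → N}
    (he : CompleteOrthogonalIdempotents e) (hpe : ∀ i, p (e i) = Pi.single i 1)
    (hcorner : ∀ i x, p x i = 0 → e i * x * e i = 0) :
    ∃ ψ : (∀ i, B i) →ₐ[F] N, ∀ i, ψ (Pi.single i 1) = e i := by
  let S := Subalgebra.centralizer F (Set.range e)
  have map_sum_corner : ∀ x, p (∑ i, e i * x * e i) = p x := fun x => by
    simp only [map_sum, map_mul, hpe]
    funext j
    rw [Finset.sum_apply, Finset.sum_eq_single j (fun i _ hij => by simp [hij.symm]) (by simp)]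
    simp
  have bij : Function.Bijective (p.comp S.val) := by
    refine ⟨(injective_iff_map_eq_zero _).mpr fun x hx => Subtype.ext ?_, fun b => ?_⟩
    · rw [← sum_corner_eq_self he x.2]
      exact Finset.sum_eq_zero fun i _ => hcorner i x (congrFun hx i)
    · obtain ⟨x, rfl⟩ := hp b
      exact ⟨⟨_, sum_corner_mem_centralizer he.toOrthogonalIdempotents x⟩, map_sum_corner x⟩
  refine ⟨S.val.comp (AlgEquiv.ofBijective _ bij).symm.toAlgHom, fun i => ?_⟩
  have e_mem : e i ∈ S := (Subalgebra.mem_centralizer_iff F).mpr <| by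
    rintro _ ⟨j, rfl⟩
    obtain rfl | hij := eq_or_ne i j
    · rfl
    · rw [he.ortho hij, he.ortho hij.symm]
  exact congrArg Subtype.val ((AlgEquiv.ofBijective _ bij).symm_apply_eq.mpr (hpe i).symm :
    _ = (⟨e i, e_mem⟩ : S))

end Splitting

section NucleusSplitting

variable {F A : Type*} [Field F] [NonAssocRing A] [Module F A] [IsScalarTower F A A]
  [SMulCommClass F A A]

instance [FiniteDimensional F A] : FiniteDimensional F (nucleus F A) :=
  inferInstanceAs (FiniteDimensional F (nucleus F A).toSubmodule)

/-- The map `x ↦ e x e` from the nucleus of `A` to `A`. -/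
def nucleusCorner (e : nucleus F A) : nucleus F A →ₗ[F] A :=
  sandwich e e ∘ₗ (nucleus F A).toSubmodule.subtype

theorem nucleusCorner_eq_coe (e x : nucleus F A) : nucleusCorner e x = (e * x * e : nucleus F A) :=
  (nucleus_mul_assoc_left e (x : A) (e : A)).symm

section

variable {B : Type*} [Ring B] [Algebra F B] {p : nucleus F A →ₐ[F] B} {e : nucleus F A}

theorem ker_nucleusCorner_le (hpe : p e = 1) :
    LinearMap.ker (nucleusCorner e) ≤ LinearMap.ker p.toLinearMap := fun x hx => by
  have corner_eq_zero : e * x * e = 0 := Subtype.ext ((nucleusCorner_eq_coe e x).symm.trans hx)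
  have := congrArg p corner_eq_zero
  rwa [map_mul, map_mul, hpe, one_mul, mul_one, map_zero] at this

variable [FiniteDimensional F A]

theorem finrank_le_finrank_range_nucleusCorner (hp : Function.Surjective p) (hpe : p e = 1) :
    Module.finrank F B ≤ Module.finrank F (LinearMap.range (nucleusCorner e)) := by
  have range_p : LinearMap.range p.toLinearMap = ⊤ := LinearMap.range_eq_top.mpr hp
  rw [← finrank_top F B, ← range_p]
  exact finrank_range_le_of_ker_le_ker (ker_nucleusCorner_le hpe)

theorem finrank_range_nucleusCorner_le (e : nucleus F A) :
    Module.finrank F (LinearMap.range (nucleusCorner e)) ≤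
      Module.finrank F (peirceComponent e e) :=
  Submodule.finrank_mono (LinearMap.range_comp_le_range _ _)

theorem corner_eq_zero_of_map_eq_zero (hp : Function.Surjective p) (hpe : p e = 1)
    (hdim : Module.finrank F (peirceComponent e e) ≤ Module.finrank F B) {x : nucleus F A}
    (hx : p x = 0) : e * x * e = 0 := by
  have ker_eq : LinearMap.ker (nucleusCorner e) = LinearMap.ker p.toLinearMap := by
    have range_p : LinearMap.range p.toLinearMap = ⊤ := LinearMap.range_eq_top.mpr hp
    refine ker_eq_ker_of_le_of_finrank_range_le (ker_nucleusCorner_le hpe) ?_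
    rw [range_p, finrank_top]
    exact (finrank_range_nucleusCorner_le e).trans hdim
  have x_mem : x ∈ LinearMap.ker (nucleusCorner e) := ker_eq.ge hx
  exact Subtype.ext ((nucleusCorner_eq_coe e x).symm.trans x_mem)

end

variable [FiniteDimensional F A] {K I : Type*} [CommRing K] [Algebra F K]
  {ι : K →ₐ[F] nucleus F A} [DecidableEq I] {B : I → Type*} [∀ i, Ring (B i)]
  [∀ i, Algebra F (B i)] [∀ i, IsSimpleRing (B i)] [∀ i, Algebra.IsCentral F (B i)]
  [∀ i, FiniteDimensional F (B i)] {p : nucleus F A →ₐ[F] ∀ i, B i}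

theorem finrank_range_mulLeft_sq_le [FiniteDimensional F K] {q : K →ₐ[F] ∀ i, B i}
    (hq : Function.Injective q) {b₀ : ∀ i, B i}
    (hb₀ : Function.Surjective fun r => bimoduleEnd q r b₀) {i : I} {k : K}
    (hk : q k = Pi.single i 1) :
    Module.finrank F (LinearMap.range (LinearMap.mulLeft F k)) ^ 2 ≤ Module.finrank F (B i) := by
  have ker_le : LinearMap.ker ((Pi.evalAlgHom F B i).comp q).toLinearMap ≤
      LinearMap.ker (LinearMap.mulLeft F k) := fun l hl => by
    have hl' : q l i = 0 := hl
    refine hq ?_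
    rw [LinearMap.mulLeft_apply, map_mul, hk, map_zero, ← Pi.single_mul_left, one_mul, hl',
      Pi.single_zero]
  rw [finrank_eq_sq_finrank_range
    (surjective_bimoduleEnd_comp (p := Pi.evalAlgHom F B i) (Function.surjective_eval i) hb₀)]
  exact Nat.pow_le_pow_left (finrank_range_le_of_ker_le_ker ker_le) 2

/-- The surjection from `e Nuc(A) e ⊆ e A e` onto `B i` and the bound
`dim e A e = (dim e K) ^ 2 ≤ dim B i` force `e Nuc(A) e` to be isomorphic to `B i`, for `e` the
lift to `K` of the identity of `B i`. -/
theorem exists_splitting [Finite I] [IsReduced K] (hι : Function.Injective ι) {m₀ : nucleus F A}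
    (hm₀ : Function.Surjective fun r => bimoduleEnd ι r m₀)
    (hrank : ∀ k k', Module.finrank F (peirceComponent (ι k) (ι k')) =
      Module.finrank F (LinearMap.range (LinearMap.mulLeft F k)) *
        Module.finrank F (LinearMap.range (LinearMap.mulLeft F k')))
    (hp : Function.Surjective p) (hnil : ∀ x, p x = 0 → IsNilpotent x) :
    ∃ ψ : (∀ i, B i) →ₐ[F] nucleus F A, ∀ i j,
      Module.finrank F (peirceComponent (ψ (Pi.single i 1)) (ψ (Pi.single j 1))) ^ 2 =
        Module.finrank F (B i) * Module.finrank F (B j) := by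
  cases nonempty_fintype I
  have : FiniteDimensional F K := .of_injective ι.toLinearMap hι
  have comp_injective : Function.Injective (p.comp ι) :=
    (injective_iff_map_eq_zero _).mpr fun k hk =>
      ((IsNilpotent.map_iff hι).mp (hnil (ι k) hk)).eq_zero
  have cyclic := surjective_bimoduleEnd_comp hp hm₀
  obtain ⟨ε, hε, hqε⟩ := exists_completeOrthogonalIdempotents_map_eq_single comp_injective cyclic
  have eval_surjective : ∀ i, Function.Surjective ((Pi.evalAlgHom F B i).comp p) := fun i =>
    (Function.surjective_eval i).comp hp
  have eval_ε : ∀ i, (Pi.evalAlgHom F B i).comp p (ι (ε i)) = 1 := fun i =>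
    (congrFun (hqε i) i).trans (Pi.single_eq_same i 1)
  have upper : ∀ i, Module.finrank F (peirceComponent (ι (ε i)) (ι (ε i))) ≤
      Module.finrank F (B i) := fun i => by
    rw [hrank, ← sq]
    exact finrank_range_mulLeft_sq_le comp_injective cyclic (hqε i)
  have finrank_B : ∀ i, Module.finrank F (LinearMap.range (LinearMap.mulLeft F (ε i))) ^ 2 =
      Module.finrank F (B i) := fun i => by
    rw [sq, ← hrank]
    exact (upper i).antisymm ((finrank_le_finrank_range_nucleusCorner (eval_surjective i)
      (eval_ε i)).trans (finrank_range_nucleusCorner_le _))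
  obtain ⟨ψ, hψ⟩ := exists_algHom_map_single_eq hp (hε.map ι.toRingHom) hqε fun i x hx =>
    corner_eq_zero_of_map_eq_zero (eval_surjective i) (eval_ε i) (upper i) hx
  refine ⟨ψ, fun i j => ?_⟩
  rw [hψ, hψ, ← finrank_B, ← finrank_B, ← mul_pow]
  exact congrArg (· ^ 2) (hrank (ε i) (ε j))

end NucleusSplitting

section MinimallyFaithful

variable {R M : Type*} [CommRing R] [IsSemisimpleRing R] [AddCommGroup M] [Module R M]

/-- If `m` has minimal annihilator `(e)` with `e` a nonzero idempotent, then adding to `m` some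
`e • a ≠ 0` shrinks the annihilator. -/
theorem exists_toSpanSingleton_injective [FaithfulSMul R M] :
    ∃ m : M, Function.Injective (LinearMap.toSpanSingleton R M m) := by
  obtain ⟨_, ⟨m, rfl⟩, minimal⟩ := WellFounded.has_min (wellFounded_lt (α := Submodule R R))
    (Set.range fun m : M => LinearMap.ker (LinearMap.toSpanSingleton R M m)) ⟨_, 0, rfl⟩
  obtain ⟨e, he, span_e⟩ := IsSemisimpleRing.ideal_eq_span_idempotent
    (LinearMap.ker (LinearMap.toSpanSingleton R M m))
  have e_smul_m : e • m = 0 := span_e.ge (Ideal.mem_span_singleton_self e)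
  refine ⟨m, LinearMap.ker_eq_bot.mp ?_⟩
  rw [span_e, Ideal.span_singleton_eq_bot]
  by_contra e_ne_zero
  obtain ⟨a, ha⟩ : ∃ a : M, e • a ≠ 0 := by
    by_contra! h
    exact e_ne_zero (FaithfulSMul.eq_of_smul_eq_smul (α := M) fun a => by rw [h a, zero_smul])
  have e_smul_add : e • (m + e • a) = e • a := by
    rw [smul_add, e_smul_m, zero_add, smul_smul, he.eq]
  have ker_le : LinearMap.ker (LinearMap.toSpanSingleton R M (m + e • a)) ≤
      LinearMap.ker (LinearMap.toSpanSingleton R M m) := fun r (hr : r • (m + e • a) = 0) => by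
    have r_smul_ea : r • e • a = 0 := by rw [← e_smul_add, smul_comm, hr, smul_zero]
    rwa [smul_add, r_smul_ea, add_zero] at hr
  refine minimal _ ⟨m + e • a, rfl⟩ (ker_le.lt_of_ne fun ker_eq => ha ?_)
  rw [← e_smul_add]
  exact ker_eq.ge e_smul_m

theorem IsMinimallyFaithful.exists_toSpanSingleton_bijective (h : IsMinimallyFaithful R M) :
    ∃ m : M, Function.Bijective (LinearMap.toSpanSingleton R M m) := by
  have := h.1
  obtain ⟨m, hm⟩ := exists_toSpanSingleton_injective (R := R) (M := M)
  refine ⟨m, hm, LinearMap.range_eq_top.mp ?_⟩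
  refine (h.2 ⊥ (LinearMap.range (LinearMap.toSpanSingleton R M m)) bot_le ⟨fun {r s} hrs => ?_⟩).2
  have mk_eq := hrs (Submodule.Quotient.mk ⟨m, 1, one_smul R m⟩)
  rw [← Submodule.Quotient.mk_smul, ← Submodule.Quotient.mk_smul, Submodule.Quotient.eq] at mk_eq
  exact hm (sub_eq_zero.mp mk_eq)

end MinimallyFaithful

section Cyclic

theorem isSemisimpleRing_of_etale (F R : Type*) [Field F] [CommRing R] [Algebra F R]
    [Algebra.Etale F R] : IsSemisimpleRing R := by
  have : Module.Finite F R := Algebra.FormallyUnramified.finite_of_free F R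
  have : IsReduced R := Algebra.FormallyUnramified.isReduced_of_field F R
  have : IsArtinianRing R := isArtinian_of_tower F inferInstance
  exact IsArtinianRing.isSemisimpleRing_of_isReduced R

variable {F : Type u} {A K : Type v} [Field F] [NonAssocRing A] [Module F A] [IsScalarTower F A A]
  [SMulCommClass F A A] [CommRing K] [Algebra F K] {ι : K →ₐ[F] nucleus F A}

theorem coe_bimoduleEnd (ι : K →ₐ[F] nucleus F A) (r : K ⊗[F] K) (x : nucleus F A) :
    ((bimoduleEnd ι r x : nucleus F A) : A) = bimoduleAction ι r x := by
  induction r with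
  | zero => simp
  | add s t hs ht =>
    rw [map_add, map_add, LinearMap.add_apply, LinearMap.add_apply, ← hs, ← ht]
    rfl
  | tmul k k' => rw [bimoduleEnd_tmul, bimoduleAction_tmul]; rfl

theorem bimoduleAction_mul_apply (ι : K →ₐ[F] nucleus F A) (r s : K ⊗[F] K) (a : A) :
    bimoduleAction ι (r * s) a = bimoduleAction ι r (bimoduleAction ι s a) := by
  rw [map_mul, Module.End.mul_apply]

theorem exists_bimoduleAction_bijective [Algebra.Etale F K]
    (h : letI : Module (K ⊗[F] K) A := Module.compHom A (bimoduleAction ι).toRingHom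
      IsMinimallyFaithful (K ⊗[F] K) A) :
    ∃ m : A, Function.Bijective fun r => bimoduleAction ι r m := by
  have : Algebra.Etale F (K ⊗[F] K) := Algebra.Etale.comp F K (K ⊗[F] K)
  have := isSemisimpleRing_of_etale F (K ⊗[F] K)
  let _ : Module (K ⊗[F] K) A := Module.compHom A (bimoduleAction ι).toRingHom
  exact IsMinimallyFaithful.exists_toSpanSingleton_bijective h

/-- The nucleus corresponds to an ideal of `K ⊗ K`, and ideals of semisimple rings are
principal. -/
theorem exists_bimoduleEnd_surjective [IsSemisimpleRing (K ⊗[F] K)] {m : A}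
    (hm : Function.Surjective fun r => bimoduleAction ι r m) :
    ∃ m₀ : nucleus F A, Function.Surjective fun r => bimoduleEnd ι r m₀ := by
  let J : Ideal (K ⊗[F] K) :=
    { (nucleus F A).toSubmodule.comap (LinearMap.applyₗ m ∘ₗ (bimoduleAction ι).toLinearMap) with
      smul_mem' := fun r s (hs : bimoduleAction ι s m ∈ nucleus F A) => by
        change bimoduleAction ι (r * s) m ∈ nucleus F A
        rw [bimoduleAction_mul_apply]
        exact coe_bimoduleEnd ι r ⟨_, hs⟩ ▸ (bimoduleEnd ι r ⟨_, hs⟩).2 }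
  obtain ⟨e, -, span_e⟩ := IsSemisimpleRing.ideal_eq_span_idempotent J
  have e_mem : bimoduleAction ι e m ∈ nucleus F A := span_e.ge (Ideal.mem_span_singleton_self e)
  refine ⟨⟨_, e_mem⟩, fun x => ?_⟩
  obtain ⟨r, hr : bimoduleAction ι r m = x⟩ := hm x
  have r_mem : r ∈ J := by
    change bimoduleAction ι r m ∈ nucleus F A
    exact hr ▸ x.2
  obtain ⟨s, rfl⟩ := Ideal.mem_span_singleton'.mp (span_e.le r_mem)
  refine ⟨s, Subtype.ext ?_⟩
  rw [coe_bimoduleEnd, ← hr, bimoduleAction_mul_apply]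

theorem finrank_peirceComponent_eq_finrank_range_mulLeft_mul {m : A}
    (hm : Function.Bijective fun r => bimoduleAction ι r m) (k k' : K) :
    Module.finrank F (peirceComponent (ι k) (ι k')) =
      Module.finrank F (LinearMap.range (LinearMap.mulLeft F k)) *
        Module.finrank F (LinearMap.range (LinearMap.mulLeft F k')) := by
  let T : K ⊗[F] K ≃ₗ[F] A :=
    .ofBijective (LinearMap.applyₗ m ∘ₗ (bimoduleAction ι).toLinearMap) hm
  have map_mulLeft : TensorProduct.map (LinearMap.mulLeft F k) (LinearMap.mulLeft F k') =
      LinearMap.mulLeft F (k ⊗ₜ k') := TensorProduct.ext' fun _ _ => by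
    simp only [TensorProduct.map_tmul, LinearMap.mulLeft_apply, Algebra.TensorProduct.tmul_mul_tmul]
  have sandwich_comp_T : sandwich (ι k) (ι k') ∘ₗ T.toLinearMap =
      T.toLinearMap ∘ₗ LinearMap.mulLeft F (k ⊗ₜ k') := LinearMap.ext fun r => by
    change (ι k : A) * (bimoduleAction ι r m * ι k') = bimoduleAction ι (k ⊗ₜ k' * r) m
    rw [bimoduleAction_mul_apply, bimoduleAction_tmul, nucleus_mul_assoc_left]
  rw [← finrank_range_tensorMap, map_mulLeft, ← LinearEquiv.finrank_map_eq T,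
    ← LinearMap.range_comp, ← sandwich_comp_T, LinearMap.range_comp_of_range_eq_top _ T.range]
  rfl

end Cyclic

section PeirceDimensions

variable {F A : Type*} [Field F] [NonAssocRing A] [Module F A] [IsScalarTower F A A]
  [SMulCommClass F A A]

theorem orthogonalIdempotents_sandwich {J J' : Type*} {x : J → nucleus F A} {y : J' → nucleus F A}
    (hx : OrthogonalIdempotents x) (hy : OrthogonalIdempotents y) :
    OrthogonalIdempotents fun s : J × J' => sandwich (x s.1) (y s.2) where
  idem s := by
    change sandwich (x s.1) (y s.2) * sandwich (x s.1) (y s.2) = sandwich (x s.1) (y s.2)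
    rw [sandwich_mul, (hx.idem _).eq, (hy.idem _).eq]
  ortho s t hst := by
    change sandwich _ _ * sandwich _ _ = 0
    rw [sandwich_mul]
    obtain hne | hne : s.1 ≠ t.1 ∨ t.2 ≠ s.2 := by
      by_contra! h
      exact hst (Prod.ext h.1 h.2.symm)
    · rw [hx.ortho hne, sandwich, map_zero, zero_mul]
    · rw [hy.ortho hne, sandwich, MulOpposite.op_zero, map_zero, mul_zero]

variable [FiniteDimensional F A]

theorem finrank_peirceComponent_sum {J J' : Type*} [Fintype J] [Fintype J'] {x : J → nucleus F A}
    {y : J' → nucleus F A} (hx : OrthogonalIdempotents x) (hy : OrthogonalIdempotents y) :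
    Module.finrank F (peirceComponent (∑ j, x j) (∑ j, y j)) =
      ∑ j, ∑ j', Module.finrank F (peirceComponent (x j) (y j')) := by
  rw [peirceComponent, sandwich_sum_sum, ← Fintype.sum_prod_type', ← Fintype.sum_prod_type',
    finrank_range_sum_orthogonalIdempotents (orthogonalIdempotents_sandwich hx hy)]
  rfl

theorem finrank_peirceComponent_le {x y x' y' u v s t : nucleus F A} (hx : u * x' * v = x)
    (hy : s * y' * t = y) :
    Module.finrank F (peirceComponent x y) ≤ Module.finrank F (peirceComponent x' y') := by
  have sandwich_eq : sandwich x y = sandwich u t * sandwich x' y' * sandwich v s := by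
    rw [sandwich_mul, sandwich_mul, hx, ← mul_assoc, hy]
  rw [peirceComponent, sandwich_eq]
  refine (Submodule.finrank_mono (LinearMap.range_comp_le_range (sandwich v s) _)).trans ?_
  rw [Module.End.mul_eq_comp, LinearMap.range_comp]
  exact Submodule.finrank_map_le _ _

end PeirceDimensions

section MatrixBlocks

variable {F A D I : Type*} [Field F] [NonAssocRing A] [Module F A]
  [IsScalarTower F A A] [SMulCommClass F A A] [DivisionRing D] [Algebra F D]
  [DecidableEq I] {k : I → ℕ}
  (ψ : (∀ i, Matrix (Fin (k i)) (Fin (k i)) D) →ₐ[F] nucleus F A)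

/-- The image of a matrix unit of the `i`-th block. -/
def blockUnit (i : I) (a b : Fin (k i)) : nucleus F A := ψ (Pi.single i (Matrix.single a b 1))

theorem blockUnit_mul (i : I) (a b c d : Fin (k i)) :
    blockUnit ψ i a b * blockUnit ψ i c d = if b = c then blockUnit ψ i a d else 0 := by
  rw [blockUnit, blockUnit, ← map_mul, ← Pi.single_mul]
  split_ifs with h
  · rw [h, Matrix.single_mul_single_same, mul_one, blockUnit]
  · rw [Matrix.single_mul_single_of_ne _ _ _ _ h, Pi.single_zero, map_zero]

theorem sum_blockUnit (i : I) : ∑ a, blockUnit ψ i a a = ψ (Pi.single i 1) := by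
  simp only [blockUnit]
  rw [← map_sum, ← Matrix.sum_single_one]
  exact congrArg ψ
    (map_sum (AddMonoidHom.single (fun i => Matrix (Fin (k i)) (Fin (k i)) D) i) _ _).symm

theorem orthogonalIdempotents_blockUnit (i : I) :
    OrthogonalIdempotents fun a => blockUnit ψ i a a where
  idem a := (blockUnit_mul ψ i a a a a).trans (if_pos rfl)
  ortho a b hab := (blockUnit_mul ψ i a a b b).trans (if_neg hab)

theorem completeOrthogonalIdempotents_blockUnit [Fintype I] :
    CompleteOrthogonalIdempotents fun s : Σ i, Fin (k i) => blockUnit ψ s.1 s.2 s.2 where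
  idem := fun ⟨i, a⟩ => (orthogonalIdempotents_blockUnit ψ i).idem a
  ortho := by
    rintro ⟨i, a⟩ ⟨j, b⟩ hne
    obtain rfl | hij := eq_or_ne i j
    · exact (orthogonalIdempotents_blockUnit ψ i).ortho fun hab => hne (congrArg _ hab)
    · change blockUnit ψ i a a * blockUnit ψ j b b = 0
      rw [blockUnit, blockUnit, ← map_mul, ← Pi.single_mul_left,
        Pi.single_eq_of_ne hij, mul_zero, Pi.single_zero, map_zero]
  complete := by
    rw [Fintype.sum_sigma]
    simp only [sum_blockUnit]
    rw [← map_sum, ← map_one ψ]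
    exact congrArg ψ (Finset.univ_sum_single 1)

theorem commute_scalar_blockUnit (d : D) (i : I) (a : Fin (k i)) :
    Commute (ψ.comp (AlgHom.pi fun i => Matrix.scalarAlgHom (Fin (k i)) F) d)
      (blockUnit ψ i a a) := by
  refine Commute.map (f := ψ) (funext fun j => ?_)
  obtain rfl | hij := eq_or_ne j i
  · ext x y
    simp [Matrix.diagonal_mul, Matrix.mul_diagonal, Matrix.single_apply]
  · simp [hij]

variable [FiniteDimensional F A]

theorem finrank_peirceComponent_blockUnit_congr (i j : I) (a a' : Fin (k i)) (b b' : Fin (k j)) :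
    Module.finrank F (peirceComponent (blockUnit ψ i a a) (blockUnit ψ j b b)) =
      Module.finrank F (peirceComponent (blockUnit ψ i a' a') (blockUnit ψ j b' b')) := by
  have conj : ∀ i (a a' : Fin (k i)),
      blockUnit ψ i a a' * blockUnit ψ i a' a' * blockUnit ψ i a' a = blockUnit ψ i a a :=
    fun i a a' => by rw [blockUnit_mul, if_pos rfl, blockUnit_mul, if_pos rfl]
  exact (finrank_peirceComponent_le (conj i a a') (conj j b b')).antisymm
    (finrank_peirceComponent_le (conj i a' a) (conj j b' b))

theorem finrank_peirceComponent_map_single (i j : I) (a : Fin (k i)) (b : Fin (k j)) :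
    Module.finrank F (peirceComponent (ψ (Pi.single i 1)) (ψ (Pi.single j 1))) =
      k i * k j * Module.finrank F
        (peirceComponent (blockUnit ψ i a a) (blockUnit ψ j b b)) := by
  rw [← sum_blockUnit, ← sum_blockUnit, finrank_peirceComponent_sum
    (orthogonalIdempotents_blockUnit ψ i) (orthogonalIdempotents_blockUnit ψ j)]
  simp only [finrank_peirceComponent_blockUnit_congr ψ i j _ a _ b, Finset.sum_const,
    Finset.card_univ, Fintype.card_fin, smul_eq_mul, mul_assoc]

theorem exists_equiv_tensor_skewMatrix_of_blocks [FiniteDimensional F D]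
    [Algebra.IsCentral F D] [Finite I] [Nonempty I] (hk : ∀ i, k i ≠ 0)
    (hψ : ∀ i j,
      Module.finrank F (peirceComponent (ψ (Pi.single i 1)) (ψ (Pi.single j 1))) ^ 2 =
        Module.finrank F (Matrix (Fin (k i)) (Fin (k i)) D) *
          Module.finrank F (Matrix (Fin (k j)) (Fin (k j)) D)) :
    ∃ (n : ℕ) (_ : 1 ≤ n) (c : ReducedSkewSet F n) (e : A ≃ₗ[F] D ⊗[F] SkewMatrix c),
      e 1 = 1 ∧ ∀ x y : A, e (x * y) = e x * e y := by
  cases nonempty_fintype I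
  have k_pos : ∀ i, 0 < k i := fun i => Nat.pos_of_ne_zero (hk i)
  have : Nonempty (Σ i, Fin (k i)) := ‹Nonempty I›.map fun i => ⟨i, 0, k_pos i⟩
  let s := (Fintype.equivFin (Σ i, Fin (k i))).symm
  refine ⟨_, Fintype.card_pos, exists_equiv_tensor_skewMatrix
    (ψ.comp (AlgHom.pi fun i => Matrix.scalarAlgHom (Fin (k i)) F))
    ((CompleteOrthogonalIdempotents.equiv s).mpr (completeOrthogonalIdempotents_blockUnit ψ))
    (fun p d => commute_scalar_blockUnit ψ d _ _) fun p q => ?_⟩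
  refine Nat.eq_of_mul_eq_mul_left (Nat.mul_pos (k_pos (s p).1) (k_pos (s q).1)) ?_
  refine (finrank_peirceComponent_map_single ψ _ _ _ _).symm.trans
    (Nat.pow_left_injective two_ne_zero ((hψ _ _).trans ?_))
  simp only [Module.finrank_matrix, Fintype.card_fin]
  ring

end MatrixBlocks

section SimpleModules

variable {R S : Type*} [Ring R] [Ring S] {V W : Type*} [AddCommGroup V] [Module R V]
  [AddCommGroup W] [Module S W]

theorem nonempty_linearEquiv_of_isSimpleModule [IsSimpleRing R] [IsArtinianRing R] [Module R W]
    [IsSimpleModule R V] [IsSimpleModule R W] : Nonempty (V ≃ₗ[R] W) := by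
  let eV := LinearEquiv.ofInjective (LinearMap.inl R V W) LinearMap.inl_injective
  let eW := LinearEquiv.ofInjective (LinearMap.inr R V W) LinearMap.inr_injective
  have := IsSimpleModule.congr eV.symm
  have := IsSimpleModule.congr eW.symm
  obtain ⟨φ⟩ := IsSimpleRing.isIsotypic R (V × W) (LinearMap.range (LinearMap.inr R V W))
    (LinearMap.range (LinearMap.inl R V W))
  exact ⟨eV.trans (φ.trans eW.symm)⟩

theorem nonempty_semilinearEquiv_of_isSimpleModule [IsSimpleRing R] [IsArtinianRing R]
    (σ : R →+* S) {τ : S →+* R} [RingHomInvPair σ τ] [RingHomInvPair τ σ] [IsSimpleModule R V]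
    [IsSimpleModule S W] : Nonempty (V ≃ₛₗ[σ] W) := by
  let : Module R W := Module.compHom W σ
  let idW : W →ₛₗ[σ] W := { AddMonoidHom.id W with map_smul' := fun _ _ => rfl }
  have : IsSimpleModule R W :=
    (idW.isSimpleModule_iff_of_bijective Function.bijective_id).mpr inferInstance
  obtain ⟨φ⟩ := nonempty_linearEquiv_of_isSimpleModule (R := R) (V := V) (W := W)
  exact ⟨{ φ with map_smul' := φ.map_smul }⟩

theorem nonempty_algEquiv_end_of_isSimpleModule {F : Type*} [CommRing F] [Algebra F R]
    [Algebra F S] [Module F V] [IsScalarTower F R V] [Module F W] [IsScalarTower F S W]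
    [IsSimpleRing R] [IsArtinianRing R] (e : R ≃ₐ[F] S) [IsSimpleModule R V]
    [IsSimpleModule S W] : Nonempty (Module.End R V ≃ₐ[F] Module.End S W) := by
  have := RingHomInvPair.of_ringEquiv e.toRingEquiv
  have := RingHomInvPair.of_ringEquiv_symm e.toRingEquiv
  obtain ⟨φ⟩ := nonempty_semilinearEquiv_of_isSimpleModule (V := V) (W := W)
    (e.toRingEquiv : R →+* S)
  have map_smul (r : F) (v : V) : φ (r • v) = r • φ v := by
    rw [← algebraMap_smul R r v, φ.map_smulₛₗ, ← algebraMap_smul S r (φ v)]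
    exact congrArg (· • φ v) (e.commutes r)
  refine ⟨AlgEquiv.ofRingEquiv (f := φ.conjRingEquiv) fun r => LinearMap.ext fun w => ?_⟩
  exact (map_smul r (φ.symm w)).trans (congrArg (r • ·) (φ.apply_symm_apply w))

end SimpleModules

section DivisionAlgebras

open scoped Matrix.Module

section

variable {J D : Type*} [Fintype J] [DecidableEq J]

instance [Nonempty J] [DivisionRing D] : IsSimpleModule (Matrix J J D) (J → D) := by
  refine isSimpleModule_iff_toSpanSingleton_surjective.mpr ⟨inferInstance, fun v hv w => ?_⟩
  obtain ⟨i, hi⟩ := Function.ne_iff.mp hv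
  refine ⟨∑ j, Matrix.single j i (w j * (v i)⁻¹), ?_⟩
  simp only [LinearMap.toSpanSingleton_apply, Finset.sum_smul, Matrix.Module.single_smul,
    smul_eq_mul, inv_mul_cancel_right₀ hi, Finset.univ_sum_single]

instance [Ring D] : SMulCommClass Dᵐᵒᵖ (Matrix J J D) (J → D) where
  smul_comm d M v := by
    funext i
    simp [Finset.sum_mul, mul_assoc]

instance {F : Type*} [CommSemiring F] [Ring D] [Algebra F D] :
    IsScalarTower F (Matrix J J D) (J → D) where
  smul_assoc r M v := by
    funext i
    simp [Finset.smul_sum]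

end

theorem nonempty_algEquiv_end_matrix (F J D : Type*) [CommRing F] [Fintype J] [DecidableEq J]
    [Nonempty J] [Ring D] [Algebra F D] :
    Nonempty (Dᵐᵒᵖ ≃ₐ[F] Module.End (Matrix J J D) (J → D)) := by
  let i := Classical.arbitrary J
  let u : J → D := Pi.single i 1
  have eq_smul_u (v : J → D) : v = (∑ j, Matrix.single j i (v j)) • u := by
    simp [u, Finset.sum_smul, Finset.univ_sum_single]
  let mulRight : Dᵐᵒᵖ →ₐ[F] Module.End (Matrix J J D) (J → D) := Algebra.lsmul F _ _
  have mulRight_u (d : D) : mulRight (.op d) u = Pi.single i d := by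
    funext j
    simp [mulRight, u, Pi.single_apply]
  refine ⟨AlgEquiv.ofBijective mulRight ⟨fun d d' h => MulOpposite.unop_injective ?_, fun f =>
    ⟨.op (f u i), LinearMap.ext fun v => ?_⟩⟩⟩
  · have := LinearMap.congr_fun h u
    rwa [← MulOpposite.op_unop d, ← MulOpposite.op_unop d', mulRight_u, mulRight_u,
      Pi.single_inj] at this
  · have apply_u : f u = Pi.single i (f u i) := calc
      f u = f (Matrix.single i i (1 : D) • u) := by rw [Matrix.Module.single_smul]; simp [u]
      _ = Pi.single i (f u i) := by rw [map_smul, Matrix.Module.single_smul, one_smul]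
    rw [eq_smul_u v, map_smul, map_smul, mulRight_u, ← apply_u]

theorem nonempty_algEquiv_of_matrix {F D D' J J' : Type*} [CommRing F] [DivisionRing D]
    [Algebra F D] [DivisionRing D'] [Algebra F D'] [Fintype J] [DecidableEq J] [Nonempty J]
    [Fintype J'] [DecidableEq J'] [Nonempty J'] (e : Matrix J J D ≃ₐ[F] Matrix J' J' D') :
    Nonempty (D ≃ₐ[F] D') := by
  obtain ⟨a⟩ := nonempty_algEquiv_end_matrix F J D
  obtain ⟨b⟩ := nonempty_algEquiv_end_of_isSimpleModule (V := J → D) (W := J' → D') e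
  obtain ⟨c⟩ := nonempty_algEquiv_end_matrix F J' D'
  exact ⟨AlgEquiv.unop (a.trans (b.trans c.symm))⟩

theorem nonempty_algEquiv_of_isBrauerEquivalent {F : Type u} [Field F] {S S' : CSA.{u, v} F}
    (h : IsBrauerEquivalent S S') {D D' J J' : Type*} [DivisionRing D] [Algebra F D]
    [DivisionRing D'] [Algebra F D'] [Fintype J] [DecidableEq J] [Nonempty J] [Fintype J']
    [DecidableEq J'] [Nonempty J'] (e : S ≃ₐ[F] Matrix J J D) (e' : S' ≃ₐ[F] Matrix J' J' D') :
    Nonempty (D ≃ₐ[F] D') := by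
  obtain ⟨n, n', hn, hn', ⟨b⟩⟩ := h
  have : NeZero n := ⟨hn⟩
  have : NeZero n' := ⟨hn'⟩
  exact nonempty_algEquiv_of_matrix <| (Matrix.compAlgEquiv (Fin n) J D F).symm.trans <|
    e.mapMatrix.symm.trans <| b.trans <| e'.mapMatrix.trans <|
    Matrix.compAlgEquiv (Fin n') J' D' F

section

variable {F S D J : Type*} [CommSemiring F] [Semiring S] [Algebra F S] [Semiring D] [Algebra F D]
  [Fintype J] [DecidableEq J] [Nonempty J]

theorem isCentral_of_algEquiv_matrix [Algebra.IsCentral F S] (e : S ≃ₐ[F] Matrix J J D) :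
    Algebra.IsCentral F D where
  out z hz := by
    let i := Classical.arbitrary J
    have scalar_mem : Matrix.scalar J z ∈ Subalgebra.center F (Matrix J J D) := by
      rw [Matrix.subalgebraCenter_eq_scalarAlgHom_map]
      exact ⟨z, hz, rfl⟩
    have symm_mem : e.symm (Matrix.scalar J z) ∈ Subalgebra.center F S :=
      (MulEquivClass.apply_mem_center_iff e.symm).mpr scalar_mem
    obtain ⟨r, hr⟩ := (Algebra.IsCentral.mem_center_iff F).mp symm_mem
    have scalar_eq : algebraMap F (Matrix J J D) r = Matrix.scalar J z := by
      rw [← e.commutes, ← hr, e.apply_symm_apply]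
    refine Algebra.mem_bot.mpr ⟨r, ?_⟩
    simpa [Matrix.algebraMap_matrix_apply] using congrFun (congrFun scalar_eq i) i

theorem finite_of_algEquiv_matrix [Module.Finite F S] (e : S ≃ₐ[F] Matrix J J D) :
    Module.Finite F D :=
  let i := Classical.arbitrary J
  .of_surjective (Matrix.entryLinearMap F D i i ∘ₗ e.toLinearMap) fun d =>
    ⟨e.symm (Matrix.of fun _ _ => d), by simp⟩

end

end DivisionAlgebras

section Atoms

theorem isNilpotent_of_mk_jacobson_eq_zero {R : Type*} [Ring R] [IsSemiprimaryRing R] {x : R}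
    (hx : Ideal.Quotient.mk (Ring.jacobson R) x = 0) : IsNilpotent x := by
  obtain ⟨N, hN⟩ := IsSemiprimaryRing.isNilpotent (R := R)
  have pow_mem := Ideal.pow_mem_pow (Ideal.Quotient.eq_zero_iff_mem.mp hx) N
  rw [hN] at pow_mem
  exact ⟨N, pow_mem⟩

variable {F : Type u} {A : Type v} [Field F] [NonAssocRing A] [Module F A] [IsScalarTower F A A]
  [SMulCommClass F A A]

theorem isAtomOf_of_algEquiv_pi {I : Type} {B : I → Type v} [∀ i, Ring (B i)]
    [∀ i, Algebra F (B i)] (e : SemisimpleQuotient F A ≃ₐ[F] ∀ i, B i) (i : I)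
    [IsSimpleRing (B i)] : IsAtomOf F A (B i) := by
  classical
  let split : (∀ j, B j) ≃ₐ[F] B i × ∀ j : {j // j ≠ i}, B j :=
    { Equiv.piSplitAt i B with
      map_mul' := fun _ _ => rfl
      map_add' := fun _ _ => rfl
      commutes' := fun _ => rfl }
  exact ⟨inferInstance, _, inferInstance, inferInstance, ⟨e.trans split⟩⟩

variable [FiniteDimensional F A]

theorem IsAtomOf.finiteDimensional {S : Type v} [Ring S] [Algebra F S] (hS : IsAtomOf F A S) :
    FiniteDimensional F S := by
  obtain ⟨-, T, _, _, ⟨e⟩⟩ := hS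
  exact .of_surjective (LinearMap.fst F S T ∘ₗ e.toLinearMap)
    (Prod.fst_surjective.comp e.surjective)

instance : IsArtinianRing (nucleus F A) := isArtinian_of_tower F inferInstance

theorem exists_algEquiv_pi_atoms (F : Type u) (A : Type v) [Field F] [NonAssocRing A]
    [Nontrivial A] [Module F A] [IsScalarTower F A A] [SMulCommClass F A A]
    [FiniteDimensional F A] :
    ∃ (n : ℕ) (B : Fin (n + 1) → Type v) (_ : ∀ i, Ring (B i)) (_ : ∀ i, Algebra F (B i)),
      (∀ i, IsAtomOf F A (B i)) ∧ Nonempty (SemisimpleQuotient F A ≃ₐ[F] ∀ i, B i) := by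
  have : Nontrivial (nucleus F A) := ⟨0, 1, fun h => zero_ne_one (congrArg Subtype.val h)⟩
  have : Nontrivial (SemisimpleQuotient F A) :=
    Ideal.Quotient.nontrivial_iff.mpr (Ring.jacobson_lt_top _).ne
  obtain ⟨_ | n, D, d, _, _, _, ⟨e⟩⟩ :=
    IsSemisimpleRing.exists_algEquiv_pi_matrix_divisionRing F (SemisimpleQuotient F A)
  · exact (not_subsingleton _ e.toEquiv.subsingleton).elim
  · exact ⟨n, _, inferInstance, inferInstance, fun i => isAtomOf_of_algEquiv_pi e i, ⟨e⟩⟩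

end Atoms

section Homogeneous

variable {F : Type u} {A : Type v} [Field F] [NonAssocRing A] [Module F A] [IsScalarTower F A A]
  [SMulCommClass F A A]

theorem IsHomogeneous.nonempty_algEquiv_of_isAtomOf (hA : IsHomogeneous F A) {S S' : Type v}
    [Ring S] [Algebra F S] [Ring S'] [Algebra F S'] (hS : IsAtomOf F A S) (hS' : IsAtomOf F A S')
    {D D' J J' : Type*} [DivisionRing D] [Algebra F D] [DivisionRing D'] [Algebra F D'] [Fintype J]
    [DecidableEq J] [Nonempty J] [Fintype J'] [DecidableEq J'] [Nonempty J']
    (e : S ≃ₐ[F] Matrix J J D) (e' : S' ≃ₐ[F] Matrix J' J' D') : Nonempty (D ≃ₐ[F] D') := by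
  obtain ⟨⟨⟨_, -⟩, central⟩, brauer⟩ := hA
  have := hS.1
  have := hS'.1
  have := hS.finiteDimensional
  have := hS'.finiteDimensional
  have := central S hS
  have := central S' hS'
  exact nonempty_algEquiv_of_isBrauerEquivalent (brauer ⟨.of F S⟩ ⟨.of F S'⟩ hS hS') e e'

theorem IsHomogeneous.exists_underlyingDivisionAlgebra (hA : IsHomogeneous F A) :
    ∃ (D : Type v) (_ : DivisionRing D) (_ : Algebra F D),
      FiniteDimensional F D ∧ Algebra.IsCentral F D ∧ IsUnderlyingDivisionAlgebra F A D := by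
  have ⟨⟨⟨_, ⟨_, _⟩, _⟩, central⟩, _⟩ := hA
  have exists_matrix (S : Type v) [Ring S] [Algebra F S] (hS : IsAtomOf F A S) :
      ∃ (k : ℕ) (_ : NeZero k) (D : Type v) (_ : DivisionRing D) (_ : Algebra F D),
        Nonempty (S ≃ₐ[F] Matrix (Fin k) (Fin k) D) := by
    have := hS.1
    have := hS.finiteDimensional
    have : IsArtinianRing S := isArtinian_of_tower F inferInstance
    exact IsSimpleRing.exists_algEquiv_matrix_divisionRing F S
  obtain ⟨n, B, _, _, atoms, -⟩ := exists_algEquiv_pi_atoms F A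
  obtain ⟨k, _, D, _, _, ⟨e⟩⟩ := exists_matrix (B 0) (atoms 0)
  have := (atoms 0).finiteDimensional
  have := central (B 0) (atoms 0)
  refine ⟨D, inferInstance, inferInstance, finite_of_algEquiv_matrix e,
    isCentral_of_algEquiv_matrix e, fun S _ _ hS => ?_⟩
  obtain ⟨k', _, D', _, _, ⟨e'⟩⟩ := exists_matrix S hS
  obtain ⟨t⟩ := hA.nonempty_algEquiv_of_isAtomOf hS (atoms 0) e' e
  exact ⟨k', NeZero.ne k', ⟨e'.trans t.mapMatrix⟩⟩

theorem IsSemicentral.exists_equiv_tensor_skewMatrix (hA : IsSemicentral F A) (D : Type w)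
    [DivisionRing D] [Algebra F D] (hD : IsUnderlyingDivisionAlgebra F A D) :
    ∃ (n : ℕ) (_ : 1 ≤ n) (c : ReducedSkewSet F n) (e : A ≃ₗ[F] D ⊗[F] SkewMatrix c),
      e 1 = 1 ∧ ∀ x y : A, e (x * y) = e x * e y := by
  obtain ⟨⟨_, ⟨_, -⟩, K, _, _, ι, _, ι_injective, hK⟩, central⟩ := hA
  obtain ⟨n, B, _, _, atoms, ⟨e⟩⟩ := exists_algEquiv_pi_atoms F A
  choose k hk t using fun i => hD (B i) (atoms i)
  have : ∀ i, NeZero (k i) := fun i => ⟨hk i⟩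
  have := (atoms 0).finiteDimensional
  have := central (B 0) (atoms 0)
  have : FiniteDimensional F D := finite_of_algEquiv_matrix (t 0).some
  have : Algebra.IsCentral F D := isCentral_of_algEquiv_matrix (t 0).some
  have : IsReduced K := Algebra.FormallyUnramified.isReduced_of_field F K
  have : Algebra.Etale F (K ⊗[F] K) := Algebra.Etale.comp F K (K ⊗[F] K)
  have := isSemisimpleRing_of_etale F (K ⊗[F] K)
  obtain ⟨m, hm⟩ := exists_bimoduleAction_bijective hK
  obtain ⟨m₀, hm₀⟩ := exists_bimoduleEnd_surjective hm.surjective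
  let e' := e.trans (AlgEquiv.piCongrRight fun i => (t i).some)
  let p := e'.toAlgHom.comp (Ideal.Quotient.mkₐ F (Ring.jacobson (nucleus F A)))
  have p_surjective : Function.Surjective p :=
    e'.surjective.comp (Ideal.Quotient.mkₐ_surjective F _)
  have isNilpotent_of_p_eq_zero : ∀ x, p x = 0 → IsNilpotent x := fun x hx =>
    isNilpotent_of_mk_jacobson_eq_zero (e'.injective (Eq.trans hx (map_zero e').symm))
  obtain ⟨ψ, hψ⟩ := exists_splitting ι_injective hm₀
    (finrank_peirceComponent_eq_finrank_range_mulLeft_mul hm) p_surjective isNilpotent_of_p_eq_zero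
  exact exists_equiv_tensor_skewMatrix_of_blocks ψ hk hψ

end Homogeneous

end Semiassociative

theorem mainTheorem10 {F : Type u} {A : Type v} [Field F] [NonAssocRing A] [Module F A]
    [IsScalarTower F A A] [SMulCommClass F A A] (hA : Semiassociative.IsHomogeneous F A) :
    (∃ (D : Type v) (_ : DivisionRing D) (_ : Algebra F D),
      FiniteDimensional F D ∧ Algebra.IsCentral F D ∧
        Semiassociative.IsUnderlyingDivisionAlgebra F A D) ∧
    ∀ (D : Type w) [DivisionRing D] [Algebra F D],
      Semiassociative.IsUnderlyingDivisionAlgebra F A D →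
        ∃ (n : ℕ) (_ : 1 ≤ n) (c : Semiassociative.ReducedSkewSet F n)
          (e : A ≃ₗ[F] D ⊗[F] Semiassociative.SkewMatrix c),
          e 1 = 1 ∧ ∀ x y : A, e (x * y) = e x * e y :=
  ⟨hA.exists_underlyingDivisionAlgebra, fun D _ _ hD => hA.1.exists_equiv_tensor_skewMatrix D hD⟩
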